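/- Let $G=(V\cup\{r\},E)$ be a finite undirected graph with a distinguished root $r\notin V$ such that the edge $(r,v)$ exists for every agent $v\in V$, and let $w\in\mathbb{R}_{\ge 0}^{E}$ be an edge weight vector. In the minimum spanning tree game of $(G,w)$ the cost of a coalition $S\subseteq V$ is $\nu_w(S)=\mathrm{OPT}(S,w)$, the minimum weight of a spanning tree of the induced subgraph $G[S\cup\{r\}]$. Theorem. There is a polynomial-time algorithm that, given $G$ and $w$, returns an allocation $x=\mathcal{A}_G(w)\in\mathbb{R}_{\ge 0}^{V}$ such that: (i) $x$ is in the $4$-approximate core of the minimum spanning tree game, that is, $\sum_{v\in S}x_v\le 4\,\nu_w(S)$ for all $S\subsetneq V$, and $\sum_{v\in V}x_v=\nu_w(V)$; (ii) for every such graph $G$, the map $\mathcal{A}_G$ has Lipschitz constant $O(1)$, explicitly $$\|\mathcal{A}_G(w)-\mathcal{A}_G(w')\|_1\le\Bigl(\frac{20}{\log 2}+1\Bigr)\|w-w'\|_1\qquad\text{for all } w,w'\in\mathbb{R}_{\ge 0}^{E},$$ where $\log$ is the natural logarithm. Here polynomial time means that a single program, independent of $G$ and $w$, computes $\mathcal{A}_G(w)$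 both for real weights, on a random access machine with unit-cost field operations and comparisons of real numbers, in time polynomial in $|V|$, and for rational weights, in exact rational arithmetic, at a bit cost polynomial in $|V|$ plus the total binary length of the weights. -/

import Mathlib

/-! ## Cost allocation games, approximate core, Lipschitz constant -/

/-- For `α ≥ 1`, the vector `x` is in the `α`-approximate core of the cost allocation game with
agent set `V` and characteristic function `ν`. -/
def InApproxCore {V : Type*} [Fintype V] (α : ℝ) (ν : Finset V → ℝ) (x : V → ℝ) : Prop :=
  (∀ S : Finset V, S ⊂ Finset.univ → ∑ v ∈ S, x v ≤ α * ν S) ∧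
    ∑ v, x v = ν Finset.univ

/-- The map `A` from weight vectors to allocations has Lipschitz constant `L`, with respect to the
`ℓ₁` norms, on the set of nonnegative weight vectors. -/
def HasLipschitzConstant {E V : Type*} [Fintype E] [Fintype V]
    (L : ℝ) (A : (E → ℝ) → V → ℝ) : Prop :=
  ∀ w w' : E → ℝ, (∀ e, 0 ≤ w e) → (∀ e, 0 ≤ w' e) →
    ∑ v, |A w v - A w' v| ≤ L * ∑ e, |w e - w' e|

/-! ## The minimum spanning tree game

The vertex set of the graph is `V ∪ {r}`, represented as `Option V` with `r = none`. -/

/-- The root is joined to every agent by an edge. -/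
def RootAdjacent {V : Type*} (G : SimpleGraph (Option V)) : Prop :=
  ∀ v : V, G.Adj none (some v)

/-- The spanning trees of the induced graph `G[S ∪ {r}]`: the trees contained in `G` whose vertex
set is exactly `S ∪ {r}`. -/
def spanningTrees {V : Type*} (G : SimpleGraph (Option V)) (S : Finset V) : Set G.Subgraph :=
  {H | H.verts = insert none (some '' (S : Set V)) ∧ H.coe.IsTree}

open Classical in
/-- The total weight of the edges of a subgraph. -/
noncomputable def subgraphWeight {V : Type*} [Fintype V] {G : SimpleGraph (Option V)}
    (w : G.edgeSet → ℝ) (H : G.Subgraph) : ℝ :=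
  ∑ e : G.edgeSet, if (e : Sym2 (Option V)) ∈ H.edgeSet then w e else 0

/-- The characteristic function of the minimum spanning tree game: `S` is mapped to the minimum
weight of a spanning tree of `G[S ∪ {r}]`. -/
noncomputable def mstGame {V : Type*} [Fintype V] (G : SimpleGraph (Option V))
    (w : G.edgeSet → ℝ) (S : Finset V) : ℝ :=
  sInf (subgraphWeight w '' spanningTrees G S)

/-! ## A random access machine over an ordered field

Programs are while programs. The memory has variables for natural numbers, (sparse, unbounded)
two-dimensional arrays of natural numbers, and two-dimensional arrays of field elements; variables
and arrays are named by numbers, and a program mentions only finitely many of them. The operations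
on field elements are the field operations, the embedding of natural numbers and comparison.

The cost of a run is logarithmic in the natural numbers that occur. For field elements it depends on
a function `size` that says what a field element costs:
* `size = 0` gives the real random access machine, with unit cost for arithmetic in the field;
* over `ℚ`, taking for `size` the length of the binary representation gives the bit model
  (logarithmic cost), which is polynomially equivalent to Turing machine time. -/

/-- The contents of the memory. -/
structure State (F : Type*) where
  /-- variables for natural numbers -/
  nvar : ℕ → ℕ
  /-- arrays of natural numbers: name, row, column -/
  narr : ℕ → ℕ → ℕ → ℕ
  /-- arrays of field elements: name, row, column -/
  farr : ℕ → ℕ → ℕ → F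

namespace State

variable {F : Type*}

/-- Assign `k` to the variable `x`. -/
def setVar (s : State F) (x k : ℕ) : State F :=
  { s with nvar := Function.update s.nvar x k }

/-- Store `k` in the cell `(i, j)` of the array `a` of natural numbers. -/
def setNat (s : State F) (a i j k : ℕ) : State F :=
  { s with narr := fun a' i' j' => if a' = a ∧ i' = i ∧ j' = j then k else s.narr a' i' j' }

/-- Store `z` in the cell `(i, j)` of the array `a` of field elements. -/
def setVal (s : State F) (a i j : ℕ) (z : F) : State F :=
  { s with farr := fun a' i' j' => if a' = a ∧ i' = i ∧ j' = j then z else s.farr a' i' j' }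

end State

/-- Expressions for natural numbers (`sub` is truncated). -/
inductive NatExpr
  | const (k : ℕ)
  | var (x : ℕ)
  | cell (a : ℕ) (i j : NatExpr)
  | add (e₁ e₂ : NatExpr)
  | sub (e₁ e₂ : NatExpr)
  | mul (e₁ e₂ : NatExpr)

/-- Expressions for field elements. -/
inductive ValExpr
  | ofNat (e : NatExpr)
  | cell (a : ℕ) (i j : NatExpr)
  | add (e₁ e₂ : ValExpr)
  | sub (e₁ e₂ : ValExpr)
  | mul (e₁ e₂ : ValExpr)
  | div (e₁ e₂ : ValExpr)

/-- Tests. -/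
inductive Test
  | natLT (e₁ e₂ : NatExpr)
  | natEq (e₁ e₂ : NatExpr)
  | valLT (e₁ e₂ : ValExpr)
  | not (b : Test)
  | and (b₁ b₂ : Test)

/-- Programs. -/
inductive Prog
  | skip
  | setVar (x : ℕ) (e : NatExpr)
  | setNat (a : ℕ) (i j e : NatExpr)
  | setVal (a : ℕ) (i j : NatExpr) (e : ValExpr)
  | seq (c₁ c₂ : Prog)
  | ite (b : Test) (c₁ c₂ : Prog)
  | while (b : Test) (c : Prog)

namespace NatExpr

variable {F : Type*}

/-- The value of an expression. -/
def eval (s : State F) : NatExpr → ℕ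
  | const k => k
  | var x => s.nvar x
  | cell a i j => s.narr a (i.eval s) (j.eval s)
  | add e₁ e₂ => e₁.eval s + e₂.eval s
  | sub e₁ e₂ => e₁.eval s - e₂.eval s
  | mul e₁ e₂ => e₁.eval s * e₂.eval s

/-- The cost of evaluating an expression: each node costs one plus the binary length of its
value. -/
def cost (s : State F) : NatExpr → ℕ
  | const k => 1 + k.size
  | var x => 1 + (s.nvar x).size
  | cell a i j => i.cost s + j.cost s + (1 + ((cell a i j).eval s).size)
  | add e₁ e₂ => e₁.cost s + e₂.cost s + (1 + ((add e₁ e₂).eval s).size)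
  | sub e₁ e₂ => e₁.cost s + e₂.cost s + (1 + ((sub e₁ e₂).eval s).size)
  | mul e₁ e₂ => e₁.cost s + e₂.cost s + (1 + ((mul e₁ e₂).eval s).size)

end NatExpr

namespace ValExpr

variable {F : Type*} [Field F]

/-- The value of an expression; as usual in Lean, the quotient by zero is zero. -/
def eval (s : State F) : ValExpr → F
  | ofNat e => (e.eval s : F)
  | cell a i j => s.farr a (i.eval s) (j.eval s)
  | add e₁ e₂ => e₁.eval s + e₂.eval s
  | sub e₁ e₂ => e₁.eval s - e₂.eval s
  | mul e₁ e₂ => e₁.eval s * e₂.eval s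
  | div e₁ e₂ => e₁.eval s / e₂.eval s

/-- The cost of evaluating an expression: each node costs one plus the size of its value. -/
def cost (size : F → ℕ) (s : State F) : ValExpr → ℕ
  | ofNat e => e.cost s + (1 + size ((ofNat e).eval s))
  | cell a i j => i.cost s + j.cost s + (1 + size ((cell a i j).eval s))
  | add e₁ e₂ => e₁.cost size s + e₂.cost size s + (1 + size ((add e₁ e₂).eval s))
  | sub e₁ e₂ => e₁.cost size s + e₂.cost size s + (1 + size ((sub e₁ e₂).eval s))
  | mul e₁ e₂ => e₁.cost size s + e₂.cost size s + (1 + size ((mul e₁ e₂).eval s))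
  | div e₁ e₂ => e₁.cost size s + e₂.cost size s + (1 + size ((div e₁ e₂).eval s))

end ValExpr

namespace Test

variable {F : Type*} [Field F] [LinearOrder F]

/-- The outcome of a test. -/
def eval (s : State F) : Test → Bool
  | natLT e₁ e₂ => decide (e₁.eval s < e₂.eval s)
  | natEq e₁ e₂ => decide (e₁.eval s = e₂.eval s)
  | valLT e₁ e₂ => decide (e₁.eval s < e₂.eval s)
  | not b => !(b.eval s)
  | and b₁ b₂ => b₁.eval s && b₂.eval s

/-- The cost of a test. -/
def cost (size : F → ℕ) (s : State F) : Test → ℕ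
  | natLT e₁ e₂ => e₁.cost s + e₂.cost s + 1
  | natEq e₁ e₂ => e₁.cost s + e₂.cost s + 1
  | valLT e₁ e₂ => e₁.cost size s + e₂.cost size s + 1
  | not b => b.cost size s + 1
  | and b₁ b₂ => b₁.cost size s + b₂.cost size s + 1

end Test

/-- `Exec size c s s' t`: the program `c`, started in the state `s`, halts in the state `s'` at
cost `t`. -/
inductive Exec {F : Type*} [Field F] [LinearOrder F] (size : F → ℕ) :
    Prog → State F → State F → ℕ → Prop
  | skip (s : State F) : Exec size .skip s s 1
  | setVar (s : State F) (x : ℕ) (e : NatExpr) :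
      Exec size (.setVar x e) s (s.setVar x (e.eval s)) (e.cost s + 1)
  | setNat (s : State F) (a : ℕ) (i j e : NatExpr) :
      Exec size (.setNat a i j e) s (s.setNat a (i.eval s) (j.eval s) (e.eval s))
        (i.cost s + j.cost s + e.cost s + 1)
  | setVal (s : State F) (a : ℕ) (i j : NatExpr) (e : ValExpr) :
      Exec size (.setVal a i j e) s (s.setVal a (i.eval s) (j.eval s) (e.eval s))
        (i.cost s + j.cost s + e.cost size s + 1)
  | seq {c₁ c₂ : Prog} {s s' s'' : State F} {t₁ t₂ : ℕ} :
      Exec size c₁ s s' t₁ → Exec size c₂ s' s'' t₂ → Exec size (.seq c₁ c₂) s s'' (t₁ + t₂ + 1)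
  | iteTrue {b : Test} {c₁ c₂ : Prog} {s s' : State F} {t : ℕ} :
      b.eval s = true → Exec size c₁ s s' t → Exec size (.ite b c₁ c₂) s s' (b.cost size s + t + 1)
  | iteFalse {b : Test} {c₁ c₂ : Prog} {s s' : State F} {t : ℕ} :
      b.eval s = false → Exec size c₂ s s' t → Exec size (.ite b c₁ c₂) s s' (b.cost size s + t + 1)
  | whileTrue {b : Test} {c : Prog} {s s' s'' : State F} {t₁ t₂ : ℕ} :
      b.eval s = true → Exec size c s s' t₁ → Exec size (.while b c) s' s'' t₂ →
        Exec size (.while b c) s s'' (b.cost size s + t₁ + t₂ + 1)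
  | whileFalse {b : Test} {c : Prog} {s : State F} :
      b.eval s = false → Exec size (.while b c) s s (b.cost size s + 1)

/-- The length of the binary representation of a rational number, by numerator and denominator. -/
def ratSize (q : ℚ) : ℕ := q.num.natAbs.size + q.den.size

/-! ## Polynomial-time allocation algorithms -/

/-- The position of a vertex in the adjacency matrix: the root comes first. -/
def vertexIndex {n : ℕ} : Option (Fin n) → ℕ
  | none => 0
  | some i => i + 1

open Classical in
/-- The memory holding the input `(G, w)`: the variable `0` holds the number `n` of agents, the
array `0` of natural numbers the adjacency matrix of `G`, the array `0` of field elements the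
symmetric matrix of the edge weights (with zeros where there is no edge). The rest is zero. -/
noncomputable def inputState {F : Type*} [Field F] {n : ℕ} (G : SimpleGraph (Option (Fin n)))
    (w : G.edgeSet → F) : State F where
  nvar x := if x = 0 then n else 0
  narr a i j := if a = 0 ∧ s(i, j) ∈ Sym2.map vertexIndex '' G.edgeSet then 1 else 0
  farr a i j := if a = 0 then
      ∑ e : G.edgeSet, if Sym2.map vertexIndex (e : Sym2 (Option (Fin n))) = s(i, j) then w e else 0
    else 0

/-- The output is read off column `0` of the array `1` of field elements. -/
def output {F : Type*} {n : ℕ} (s : State F) (v : Fin n) : F := s.farr 1 v 0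

/-- An allocation method: for each graph on `n` agents and a root, a map from weight vectors to
vectors indexed by the agents. -/
abbrev AllocationMethod : Type :=
  (n : ℕ) → (G : SimpleGraph (Option (Fin n))) → (G.edgeSet → ℝ) → Fin n → ℝ

open Classical in
/-- The allocation method `A` for minimum spanning tree games is computed by a polynomial-time
algorithm. One and the same program computes `A`
* for all real weights, on the real random access machine, in time polynomial in the number of
  agents (this number and the size of the graph bound each other polynomially);
* for all rational weights, in exact rational arithmetic, at a bit cost polynomial in the number of
  agents plus the length of the binary representation of the weights. -/
def IsPolynomialTime (A : AllocationMethod) : Prop :=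
  ∃ (c : Prog) (p q : Polynomial ℕ), ∀ (n : ℕ) (G : SimpleGraph (Option (Fin n))), RootAdjacent G →
    (∀ w : G.edgeSet → ℝ, (∀ e, 0 ≤ w e) →
      ∃ (s : State ℝ) (t : ℕ), Exec (fun _ => 0) c (inputState G w) s t ∧
        t ≤ p.eval n ∧ ∀ v, output s v = A n G w v) ∧
    (∀ w : G.edgeSet → ℚ, (∀ e, 0 ≤ w e) →
      ∃ (s : State ℚ) (t : ℕ), Exec ratSize c (inputState G w) s t ∧
        t ≤ q.eval (n + ∑ e, ratSize (w e)) ∧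
        ∀ v, ((output s v : ℚ) : ℝ) = A n G (fun e => (w e : ℝ)) v)

/-!
The allocation is the marginal vector of the bottleneck costs. Number the vertices `0, …, n` with the
root first, and let `m(u, v)` be the least possible largest edge weight on a path from `u` to `v`.
The agent `v` pays the minimum of `m(u, v)` over the vertices `u < v`. In terms of Kruskal's
algorithm: at time `t`, the agents who still pay are the smallest vertices of the components of the
graph of edges of weight at most `t`, except the component of the root. This allocation lies in the
exact core and its Lipschitz constant is `1`, which is more than is asked for.

It is computed by vertex elimination (`allocate`): the last vertex pays its cheapest edge, and is
then eliminated by allowing the detour through it for every remaining pair (`eliminate`). A pair that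
is not an edge of the graph starts with the bottleneck cost of the path through the root
(`completion`), so that no infinite weights are needed. Hence:

* Core: for a spanning tree on `S ∪ {0}`, the largest member of `S` pays at most its cheapest tree
  edge; contract this edge and use induction (`sum_allocate_le`).
* Efficiency: the payments buy a spanning tree. Extend a tree of the smaller vertices by the cheapest
  edge of the last vertex, and replace one by one the edges `ab` that owe their weight to a detour
  through `u` by one of `au` and `bu`, whichever keeps the network connected
  (`exists_linked_of_hub`, `exists_linked_sum_eq`).
* Lipschitz constant: the allocation is monotone in the weights. So for `u ≤ w` the `ℓ₁` distance of
  the allocations is the difference of the two minimum spanning tree weights, which is at most the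
  `ℓ₁` distance of the weights; two arbitrary weight vectors are compared through their pointwise
  minimum.
* Running time: there are three nested loops over the vertices, and field elements are only compared
  and copied. So no field elements but zero and the input weights ever arise, and the same program
  runs over the reals and the rationals (`runs_allocationProg`, `map_allocate`).
-/

/-! ### The allocation rule on weight matrices -/

section Matrices

variable {F : Type*} [LinearOrder F]

/-- The minimum of `f 0, …, f (k - 1)` for `k ≥ 1`; the starting value is `f 0`. -/
def prefixMin (f : ℕ → F) : ℕ → F
  | 0 => f 0
  | k + 1 => min (prefixMin f k) (f k)

/-- Vertex elimination: the weight matrix in which every pair `i, j` may also be joined by the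
detour through `v`, the cost of a path being its largest edge weight. -/
def eliminate (v : ℕ) (W : ℕ → ℕ → F) (i j : ℕ) : F :=
  min (W i j) (max (W i v) (W v j))

/-- The allocation rule for the complete graph on `0, …, m` with root `0` and edge weights `W`:
the last vertex `m` pays its cheapest edge and is then eliminated. So `v` pays the least bottleneck
cost of a path from `v` to a smaller vertex. -/
def allocate : ℕ → (ℕ → ℕ → F) → ℕ → F
  | 0, W, _ => W 0 0
  | m + 1, W, v =>
    if v = m + 1 then prefixMin (W (m + 1)) (m + 1) else allocate m (eliminate (m + 1) W) v

theorem prefixMin_le (f : ℕ → F) {k u : ℕ} (h : u < k) : prefixMin f k ≤ f u := by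
  induction k with
  | zero => omega
  | succ k ih =>
    rcases Nat.lt_succ_iff_lt_or_eq.mp h with h | rfl
    · exact (min_le_left _ _).trans (ih h)
    · exact min_le_right _ _

theorem exists_prefixMin_eq (f : ℕ → F) (k : ℕ) : ∃ u ≤ k, prefixMin f (k + 1) = f u := by
  induction k with
  | zero => exact ⟨0, le_rfl, by simp [prefixMin]⟩
  | succ k ih =>
    obtain ⟨u, hu, h⟩ := ih
    rw [prefixMin]
    rcases min_choice (prefixMin f (k + 1)) (f (k + 1)) with h' | h'
    · exact ⟨u, by omega, h'.trans h⟩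
    · exact ⟨k + 1, le_rfl, h'⟩

theorem prefixMin_congr {f g : ℕ → F} {m k : ℕ} (h : ∀ i ≤ m, f i = g i) (hk : k ≤ m + 1) :
    prefixMin f k = prefixMin g k := by
  induction k with
  | zero => exact h 0 (Nat.zero_le _)
  | succ k ih => rw [prefixMin, prefixMin, ih (by omega), h k (by omega)]

theorem prefixMin_mono {f g : ℕ → F} (h : ∀ i, f i ≤ g i) (k : ℕ) :
    prefixMin f k ≤ prefixMin g k := by
  induction k with
  | zero => exact h 0
  | succ k ih => exact min_le_min ih (h k)

theorem eliminate_mono {W W' : ℕ → ℕ → F} (h : ∀ i j, W i j ≤ W' i j) (v i j : ℕ) :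
    eliminate v W i j ≤ eliminate v W' i j :=
  min_le_min (h i j) (max_le_max (h i v) (h v j))

theorem eliminate_symm {W : ℕ → ℕ → F} (h : ∀ i j, W i j = W j i) (v i j : ℕ) :
    eliminate v W i j = eliminate v W j i := by
  rw [eliminate, eliminate, h i j, h i v, h v j, max_comm]

theorem allocate_last (m : ℕ) (W : ℕ → ℕ → F) :
    allocate (m + 1) W (m + 1) = prefixMin (W (m + 1)) (m + 1) :=
  if_pos rfl

theorem allocate_of_ne {m v : ℕ} (W : ℕ → ℕ → F) (h : v ≠ m + 1) :
    allocate (m + 1) W v = allocate m (eliminate (m + 1) W) v :=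
  if_neg h

theorem allocate_mono (m : ℕ) {W W' : ℕ → ℕ → F} (h : ∀ i j, W i j ≤ W' i j) (v : ℕ) :
    allocate m W v ≤ allocate m W' v := by
  induction m generalizing W W' with
  | zero => exact h 0 0
  | succ m ih =>
    rw [allocate, allocate]
    split_ifs
    · exact prefixMin_mono (h _) _
    · exact ih (eliminate_mono h _)

theorem allocate_congr {m : ℕ} {W W' : ℕ → ℕ → F} (h : ∀ i ≤ m, ∀ j ≤ m, W i j = W' i j) (v : ℕ) :
    allocate m W v = allocate m W' v := by
  induction m generalizing W W' with
  | zero => exact h 0 le_rfl 0 le_rfl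
  | succ m ih =>
    rw [allocate, allocate, prefixMin_congr (h _ le_rfl) (by omega)]
    congr 1
    refine ih fun i hi j hj => ?_
    rw [eliminate, eliminate, h i (by omega) j (by omega), h i (by omega) _ le_rfl,
      h _ le_rfl j (by omega)]

/-- All operations of the rule are minima and maxima, so it commutes with monotone maps. -/
theorem map_allocate {F' : Type*} [LinearOrder F'] {φ : F → F'} (hφ : Monotone φ) (m : ℕ)
    (W : ℕ → ℕ → F) (v : ℕ) :
    φ (allocate m W v) = allocate m (fun i j => φ (W i j)) v := by
  have hmin : ∀ (f : ℕ → F) (k : ℕ), φ (prefixMin f k) = prefixMin (fun i => φ (f i)) k := by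
    intro f k
    induction k with
    | zero => rfl
    | succ k ih => rw [prefixMin, prefixMin, hφ.map_min, ih]
  induction m generalizing W with
  | zero => rfl
  | succ m ih =>
    rw [allocate, allocate, ← hmin, apply_ite φ, ih]
    congr 2
    funext i j
    simp only [eliminate, hφ.map_min, hφ.map_max]

theorem le_allocate {z : F} (m : ℕ) {W : ℕ → ℕ → F} (h : ∀ i j, z ≤ W i j) (v : ℕ) :
    z ≤ allocate m W v := by
  induction m generalizing W with
  | zero => exact h 0 0
  | succ m ih =>
    rw [allocate]
    split_ifs
    · obtain ⟨u, -, hu⟩ := exists_prefixMin_eq (W (m + 1)) m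
      exact hu ▸ h _ u
    · exact ih fun i j => le_min (h i j) (le_max_of_le_left (h i _))

end Matrices

/-! ### Connectivity by multisets of weighted edges -/

section Links

variable {α : Type*}

/-- The equivalence relation generated by a multiset of weighted edges `(a, b, t)`. -/
def Linked (L : Multiset (α × α × ℝ)) : α → α → Prop :=
  Relation.EqvGen fun a b => ∃ t, (a, b, t) ∈ L

theorem Linked.of_mem {L : Multiset (α × α × ℝ)} {a b : α} {t : ℝ} (h : (a, b, t) ∈ L) :
    Linked L a b :=
  .rel _ _ ⟨t, h⟩

theorem Linked.refl {L : Multiset (α × α × ℝ)} (a : α) : Linked L a a :=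
  Relation.EqvGen.refl a

theorem Linked.symm {L : Multiset (α × α × ℝ)} {a b : α} (h : Linked L a b) : Linked L b a :=
  Relation.EqvGen.symm _ _ h

theorem Linked.trans {L : Multiset (α × α × ℝ)} {a b c : α} (h : Linked L a b)
    (h' : Linked L b c) : Linked L a c :=
  Relation.EqvGen.trans _ _ _ h h'

/-- An equivalence relation that contains the image of every edge contains the image of every
linked pair. -/
theorem Linked.lift {β : Type*} {L : Multiset (α × α × ℝ)} {r : β → β → Prop}
    (hr : Equivalence r) (f : α → β) (hL : ∀ a b t, (a, b, t) ∈ L → r (f a) (f b)) {a b : α}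
    (h : Linked L a b) : r (f a) (f b) := by
  induction h with
  | rel a b h => exact hL a b _ h.choose_spec
  | refl a => exact hr.refl _
  | symm a b _ ih => exact hr.symm ih
  | trans a b c _ _ ih ih' => exact hr.trans ih ih'

theorem Linked.equivalence (L : Multiset (α × α × ℝ)) : Equivalence (Linked L) :=
  ⟨.refl, .symm, .trans⟩

theorem Linked.mono {L L' : Multiset (α × α × ℝ)} (h : L ≤ L') {a b : α} (hab : Linked L a b) :
    Linked L' a b :=
  hab.lift (Linked.equivalence _) id fun _ _ _ hm => .of_mem (Multiset.mem_of_le h hm)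

/-- In a connected network, the edge `ab` may be replaced by `au` or by `bu`: removing `ab` leaves
`u` on the side of `a` or on that of `b`. -/
theorem Linked.replace {L : Multiset (α × α × ℝ)} {U : Set α} {a b u : α} {t : ℝ}
    (h : ∀ x ∈ U, Linked ((a, b, t) ::ₘ L) x u) :
    (∀ x ∈ U, Linked ((a, u, t) ::ₘ L) x u) ∨ ∀ x ∈ U, Linked ((b, u, t) ::ₘ L) x u := by
  by_cases hb : Linked L b u
  · refine .inl fun x hx => (h x hx).lift (Linked.equivalence _) id fun c d s hm => ?_
    rcases Multiset.mem_cons.mp hm with hm | hm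
    · obtain ⟨rfl, rfl, rfl⟩ : c = a ∧ d = b ∧ s = t := by simpa using hm
      exact (Linked.of_mem (Multiset.mem_cons_self _ _)).trans
        (hb.mono (Multiset.le_cons_self _ _)).symm
    · exact .of_mem (Multiset.mem_cons_of_mem hm)
  by_cases ha : Linked L a u
  · refine .inr fun x hx => (h x hx).lift (Linked.equivalence _) id fun c d s hm => ?_
    rcases Multiset.mem_cons.mp hm with hm | hm
    · obtain ⟨rfl, rfl, rfl⟩ : c = a ∧ d = b ∧ s = t := by simpa using hm
      exact (ha.mono (Multiset.le_cons_self _ _)).trans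
        (Linked.of_mem (Multiset.mem_cons_self _ _)).symm
    · exact .of_mem (Multiset.mem_cons_of_mem hm)
  -- If neither end is linked to `u` without `ab`, then `ab` is not needed at all.
  · refine .inl fun x hx => ?_
    have key : Linked L x u ↔ Linked L u u := by
      refine (h x hx).lift (r := Iff) ⟨Iff.refl, Iff.symm, Iff.trans⟩ (fun y => Linked L y u)
        fun c d s hm => ?_
      rcases Multiset.mem_cons.mp hm with hm | hm
      · obtain ⟨rfl, rfl, rfl⟩ : c = a ∧ d = b ∧ s = t := by simpa using hm
        exact iff_of_false ha hb
      · exact ⟨(Linked.of_mem hm).symm.trans, (Linked.of_mem hm).trans⟩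
    exact (key.mpr (.refl u)).mono (Multiset.le_cons_self _ _)

/-- If every edge `ab` of a connected network is available itself or may be rerouted to the hub `u`
from either end at the same cost, then there is a connected network of available edges of the same
total cost. -/
theorem exists_linked_of_hub {U : Set α} {u : α} {R : α → α → ℝ → Prop}
    {L : Multiset (α × α × ℝ)} (h : ∀ x ∈ U, Linked L x u)
    (hL : ∀ a b t, (a, b, t) ∈ L → R a b t ∨ R a u t ∧ R b u t) :
    ∃ L' : Multiset (α × α × ℝ), (∀ x ∈ U, Linked L' x u) ∧
      (∀ a b t, (a, b, t) ∈ L' → R a b t) ∧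
      (L'.map fun e => e.2.2).sum = (L.map fun e => e.2.2).sum := by
  suffices H : ∀ D : Multiset (α × α × ℝ), (∀ a b t, (a, b, t) ∈ D → R a b t) →
      (∀ x ∈ U, Linked (L + D) x u) → ∃ L' : Multiset (α × α × ℝ), (∀ x ∈ U, Linked L' x u) ∧
      (∀ a b t, (a, b, t) ∈ L' → R a b t) ∧
      (L'.map fun e => e.2.2).sum = ((L + D).map fun e => e.2.2).sum by
    simpa using H 0 (by simp) (by simpa using h)
  clear h
  induction L using Multiset.induction_on with
  | empty => exact fun D hD h => ⟨D, by simpa using h, hD, by simp⟩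
  | cons e L ih =>
    obtain ⟨a, b, t⟩ := e
    intro D hD h
    have ih := ih fun c d s hm => hL c d s (Multiset.mem_cons_of_mem hm)
    -- It suffices to move one edge of the same cost from the pending part to the finished part.
    have step : ∀ c d, R c d t → (∀ x ∈ U, Linked ((c, d, t) ::ₘ (L + D)) x u) →
        ∃ L' : Multiset (α × α × ℝ), (∀ x ∈ U, Linked L' x u) ∧
          (∀ a b t, (a, b, t) ∈ L' → R a b t) ∧
          (L'.map fun e => e.2.2).sum = (((a, b, t) ::ₘ L + D).map fun e => e.2.2).sum := by
      intro c d hcd hlink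
      obtain ⟨L', h1, h2, h3⟩ := ih ((c, d, t) ::ₘ D) (by
        intro a' b' t' hm
        rcases Multiset.mem_cons.mp hm with hm | hm
        · obtain ⟨rfl, rfl, rfl⟩ : a' = c ∧ b' = d ∧ t' = t := by simpa using hm
          exact hcd
        · exact hD _ _ _ hm) (by simpa using hlink)
      refine ⟨L', h1, h2, h3.trans ?_⟩
      simp only [Multiset.map_add, Multiset.map_cons, Multiset.sum_add, Multiset.sum_cons]
      ring
    rw [Multiset.cons_add] at h
    rcases hL a b t (Multiset.mem_cons_self _ _) with hab | ⟨hau, hbu⟩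
    · exact step a b hab h
    · rcases Linked.replace h with h | h
      · exact step a u hau h
      · exact step b u hbu h

end Links

/-! ### The rule and connected networks -/

/-- An edge `ab` of cost `t` is affordable if it is a loop or if its weight is at most `t`. -/
def Affordable (W : ℕ → ℕ → ℝ) (a b : ℕ) (t : ℝ) : Prop :=
  0 ≤ t ∧ (a = b ∨ W a b ≤ t)

/-- The rule is in the core: no coalition `S` pays more than a network of affordable edges inside
`S ∪ {0}` that connects it to the root. The largest member of `S` pays at most the cheapest edge of
the network at it; contracting this edge gives a network for the remaining members, affordable after
the elimination. -/
theorem sum_allocate_le (m : ℕ) {W : ℕ → ℕ → ℝ} (hW : ∀ i j, W i j = W j i) {S : Finset ℕ}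
    (hS : ∀ v ∈ S, 1 ≤ v ∧ v ≤ m) {L : Multiset (ℕ × ℕ × ℝ)}
    (hL : ∀ a b t, (a, b, t) ∈ L →
      (a ∈ S ∨ a = 0) ∧ (b ∈ S ∨ b = 0) ∧ Affordable W a b t)
    (hlink : ∀ v ∈ S, Linked L v 0) :
    ∑ v ∈ S, allocate m W v ≤ (L.map fun e => e.2.2).sum := by
  induction m generalizing W S L with
  | zero =>
    have : S = ∅ := Finset.eq_empty_of_forall_notMem fun v hv => by have := hS v hv; omega
    subst this
    refine Multiset.sum_nonneg fun x hx => ?_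
    obtain ⟨⟨a, b, t⟩, he, rfl⟩ := Multiset.mem_map.mp hx
    exact (hL a b t he).2.2.1
  | succ m ih =>
    by_cases hm : m + 1 ∈ S
    swap
    · have hne : ∀ v ∈ S, v ≠ m + 1 := fun v hv h => hm (h ▸ hv)
      rw [Finset.sum_congr rfl fun v hv => allocate_of_ne W (hne v hv)]
      refine ih (eliminate_symm hW _) (fun v hv => ?_) (fun a b t he => ?_) hlink
      · have := hS v hv; have := hne v hv; omega
      · obtain ⟨ha, hb, h0, hab⟩ := hL a b t he
        exact ⟨ha, hb, h0, hab.imp_right (min_le_left _ _).trans⟩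
    set v := m + 1 with hv
    -- The edges of the network at `v`, apart from loops, as pairs (neighbour, cost).
    let P : ℕ × ℕ × ℝ → Prop := fun e => (e.1 = v ∧ e.2.1 ≠ v) ∨ (e.1 ≠ v ∧ e.2.1 = v)
    have hex : ∃ e ∈ L, P e := by
      by_contra! hno
      have : (v = v) = (0 = v) := by
        refine (hlink v hm).lift (r := Eq) ⟨fun _ => rfl, Eq.symm, Eq.trans⟩ (fun y => y = v)
          fun a b t he => ?_
        have := hno _ he
        simp only [P] at this
        apply propext
        tauto
      simp [hv] at this
    obtain ⟨e, he, hmin⟩ : ∃ e, (e ∈ L ∧ P e) ∧ ∀ e', e' ∈ L ∧ P e' → e.2.2 ≤ e'.2.2 := by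
      classical
      obtain ⟨e, he, hP⟩ := hex
      obtain ⟨e, he, hmin⟩ := (L.toFinset.filter P).exists_min_image (fun e => e.2.2)
        ⟨e, by simp [he, hP]⟩
      exact ⟨e, by simpa using he, fun e' he' => hmin e' (by simpa using he')⟩
    obtain ⟨c, d, t⟩ := e
    obtain ⟨L', rfl⟩ := Multiset.exists_cons_of_mem he.1
    obtain ⟨u, huv, huS, hut, hcd⟩ : ∃ u, u ≠ v ∧ (u ∈ S ∨ u = 0) ∧ W u v ≤ t ∧
        (c = v ∧ d = u ∨ c = u ∧ d = v) := by
      obtain ⟨hc, hd, h0, hW'⟩ := hL c d t he.1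
      rcases he.2 with ⟨h1, h2⟩ | ⟨h1, h2⟩ <;> simp only at h1 h2
      · exact ⟨d, h2, hd, by rw [hW, ← h1]; exact hW'.resolve_left (by rw [h1]; exact h2.symm),
          .inl ⟨h1, rfl⟩⟩
      · exact ⟨c, h1, hc, by rw [← h2]; exact hW'.resolve_left (by rw [h2]; exact h1),
          .inr ⟨rfl, h2⟩⟩
    have hum : u < m + 1 := by
      rcases huS with h | h
      · have := hS u h; omega
      · omega
    let f : ℕ → ℕ := fun x => if x = v then u else x
    have hfv : f v = u := if_pos rfl
    have hfne : ∀ x, x ≠ v → f x = x := fun x hx => if_neg hx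
    have hfS : ∀ x, x ∈ S ∨ x = 0 → f x ∈ S.erase v ∨ f x = 0 := by
      intro x hx
      by_cases hxv : x = v
      · rw [hxv, hfv]; exact huS.imp_left fun h => Finset.mem_erase.mpr ⟨huv, h⟩
      · rw [hfne x hxv]; exact hx.imp_left fun h => Finset.mem_erase.mpr ⟨hxv, h⟩
    have hfL : ∀ x y, Linked ((c, d, t) ::ₘ L') x y →
        Linked (L'.map fun e => (f e.1, f e.2.1, e.2.2)) (f x) (f y) := by
      intro x y hxy
      refine hxy.lift (Linked.equivalence _) f fun a b s hm => ?_
      rcases Multiset.mem_cons.mp hm with hm | hm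
      · obtain ⟨rfl, rfl, rfl⟩ : a = c ∧ b = d ∧ s = t := by simpa using hm
        have : f a = f b := by
          rcases hcd with ⟨rfl, rfl⟩ | ⟨rfl, rfl⟩
          · rw [hfv, hfne _ huv]
          · rw [hfv, hfne _ huv]
        rw [this]
        exact .refl _
      · exact .of_mem (t := s) (Multiset.mem_map.mpr ⟨(a, b, s), hm, rfl⟩)
    rw [← Finset.add_sum_erase S _ hm, Multiset.map_cons, Multiset.sum_cons, allocate_last]
    refine add_le_add ((prefixMin_le _ hum).trans (by rw [hW]; exact hut)) ?_
    rw [Finset.sum_congr rfl fun x hx => allocate_of_ne W (Finset.ne_of_mem_erase hx)]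
    have hIH := ih (eliminate_symm hW v) (S := S.erase v)
      (L := L'.map fun e => (f e.1, f e.2.1, e.2.2)) ?_ ?_ ?_
    · simpa [Multiset.map_map, Function.comp_def] using hIH
    · intro x hx
      obtain ⟨hxv, hx⟩ := Finset.mem_erase.mp hx
      have := hS x hx
      omega
    · intro a' b' s hm
      obtain ⟨⟨a, b, s'⟩, hmem, heq⟩ := Multiset.mem_map.mp hm
      obtain ⟨rfl, rfl, rfl⟩ : f a = a' ∧ f b = b' ∧ s' = s := by simpa using heq
      obtain ⟨ha, hb, h0, hab⟩ := hL a b s' (Multiset.mem_cons_of_mem hmem)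
      refine ⟨hfS a ha, hfS b hb, h0, ?_⟩
      by_cases hav : a = v <;> by_cases hbv : b = v
      · left; rw [hav, hbv]
      · right
        have hts : t ≤ s' := hmin (a, b, s') ⟨Multiset.mem_cons_of_mem hmem, .inl ⟨hav, hbv⟩⟩
        rw [hav] at hab
        rw [hav, hfv, hfne b hbv]
        exact (min_le_right _ _).trans
          (max_le (hut.trans hts) (hab.resolve_left (Ne.symm hbv)))
      · right
        have hts : t ≤ s' := hmin (a, b, s') ⟨Multiset.mem_cons_of_mem hmem, .inr ⟨hav, hbv⟩⟩
        rw [hbv] at hab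
        rw [hbv, hfv, hfne a hav]
        exact (min_le_right _ _).trans
          (max_le (hab.resolve_left hav) (by rw [hW]; exact hut.trans hts))
      · rw [hfne a hav, hfne b hbv]
        exact hab.imp_right (min_le_left _ _).trans
    · intro x hx
      obtain ⟨hxv, hx⟩ := Finset.mem_erase.mp hx
      have := hfL x 0 (hlink x hx)
      rwa [hfne x hxv, hfne 0 (by omega)] at this

/-- The payments suffice for a network that connects all vertices: join the last vertex to the
network of the others by its cheapest edge, and reroute the edges that were made cheaper by the
elimination to the last vertex. -/
theorem exists_linked_sum_eq (m : ℕ) {W : ℕ → ℕ → ℝ} (hW : ∀ i j, W i j = W j i)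
    (h0 : ∀ i j, 0 ≤ W i j) :
    ∃ L : Multiset (ℕ × ℕ × ℝ),
      (∀ a b t, (a, b, t) ∈ L → a ≤ m ∧ b ≤ m ∧ Affordable W a b t) ∧
      (∀ v ≤ m, Linked L v 0) ∧
      (L.map fun e => e.2.2).sum = ∑ v ∈ Finset.Icc 1 m, allocate m W v := by
  induction m generalizing W with
  | zero =>
    refine ⟨0, by simp, fun v hv => ?_, by simp⟩
    rw [Nat.le_zero.mp hv]
    exact .refl 0
  | succ m ih =>
    obtain ⟨L, hL, hlink, hsum⟩ := ih (eliminate_symm hW (m + 1))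
      fun i j => le_min (h0 i j) (le_max_of_le_left (h0 i _))
    obtain ⟨u, hum, hu⟩ := exists_prefixMin_eq (W (m + 1)) m
    have hlink₁ : ∀ x ∈ {x | x ≤ m + 1}, Linked ((m + 1, u, W (m + 1) u) ::ₘ L) x (m + 1) := by
      have hle := Multiset.le_cons_self L (m + 1, u, W (m + 1) u)
      have hlast : Linked ((m + 1, u, W (m + 1) u) ::ₘ L) 0 (m + 1) :=
        ((hlink u hum).mono hle).symm.trans (Linked.of_mem (Multiset.mem_cons_self _ _)).symm
      intro x hx
      rcases Nat.lt_or_eq_of_le hx with hx | rfl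
      · exact ((hlink x (by omega)).mono hle).trans hlast
      · exact .refl _
    obtain ⟨L', hlink', hL', hsum'⟩ := exists_linked_of_hub
      (R := fun a b t => a ≤ m + 1 ∧ b ≤ m + 1 ∧ Affordable W a b t) hlink₁ fun a b t hm => by
        rcases Multiset.mem_cons.mp hm with hm | hm
        · obtain ⟨rfl, rfl, rfl⟩ : a = m + 1 ∧ b = u ∧ t = W (m + 1) u := by simpa using hm
          exact .inl ⟨le_rfl, by omega, h0 _ _, .inr le_rfl⟩
        · obtain ⟨ha, hb, ht, hab⟩ := hL a b t hm
          rcases hab with hab | hab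
          · exact .inl ⟨by omega, by omega, ht, .inl hab⟩
          rcases min_le_iff.mp hab with hab | hab
          · exact .inl ⟨by omega, by omega, ht, .inr hab⟩
          · obtain ⟨h1, h2⟩ := max_le_iff.mp hab
            exact .inr ⟨⟨by omega, le_rfl, ht, .inr h1⟩, by omega, le_rfl, ht,
              .inr (by rwa [hW])⟩
    refine ⟨L', hL', fun v hv => (hlink' v hv).trans (hlink' 0 (Nat.zero_le _)).symm, ?_⟩
    rw [hsum', Multiset.map_cons, Multiset.sum_cons, hsum,
      ← Finset.insert_Icc_right_eq_Icc_add_one (by omega), Finset.sum_insert (by simp),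
      allocate_last, hu]
    congr 1
    refine Finset.sum_congr rfl fun v hv => (allocate_of_ne W ?_).symm
    have := Finset.mem_Icc.mp hv
    omega

/-! ### Total correctness with costs for while programs -/

section Memory

variable {F : Type*} {size : F → ℕ}

theorem size_min_le [LinearOrder F] {D : ℕ} {y z : F} (hy : size y ≤ D) (hz : size z ≤ D) :
    size (min y z) ≤ D := by
  rcases min_choice y z with h | h <;> rw [h] <;> assumption

theorem size_max_le [LinearOrder F] {D : ℕ} {y z : F} (hy : size y ≤ D) (hz : size z ≤ D) :
    size (max y z) ≤ D := by
  rcases max_choice y z with h | h <;> rw [h] <;> assumption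

/-- All memory contents have size at most `D`. -/
def SizeBounded (size : F → ℕ) (D : ℕ) (s : State F) : Prop :=
  (∀ x, (s.nvar x).size ≤ D) ∧ (∀ a i j, (s.narr a i j).size ≤ D) ∧ ∀ a i j, size (s.farr a i j) ≤ D

namespace SizeBounded

variable {D : ℕ} {s : State F}

theorem setVar (h : SizeBounded size D s) (x : ℕ) {k : ℕ} (hk : k.size ≤ D) :
    SizeBounded size D (s.setVar x k) := by
  refine ⟨fun y => ?_, h.2⟩
  by_cases hy : y = x
  · subst hy; simpa [State.setVar] using hk
  · simpa [State.setVar, hy] using h.1 y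

theorem setVal (h : SizeBounded size D s) (a i j : ℕ) {z : F} (hz : size z ≤ D) :
    SizeBounded size D (s.setVal a i j z) := by
  refine ⟨h.1, h.2.1, fun a' i' j' => ?_⟩
  simp only [State.setVal]
  split_ifs
  · exact hz
  · exact h.2.2 _ _ _

theorem cost_var (h : SizeBounded size D s) (x : ℕ) : (NatExpr.var x).cost s ≤ D + 1 := by
  have := h.1 x
  simp only [NatExpr.cost]
  omega

theorem cost_pred (h : SizeBounded size D s) (x : ℕ) :
    (NatExpr.sub (.var x) (.const 1)).cost s ≤ 2 * D + 4 := by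
  have := h.1 x
  have := Nat.size_le_size (Nat.sub_le (s.nvar x) 1)
  simp only [NatExpr.cost, NatExpr.eval, Nat.size_one]
  omega

theorem cost_natCell (h : SizeBounded size D s) (a : ℕ) (i j : NatExpr) :
    (NatExpr.cell a i j).cost s ≤ i.cost s + j.cost s + (D + 1) := by
  have := h.2.1 a (i.eval s) (j.eval s)
  simp only [NatExpr.cost, NatExpr.eval]
  omega

theorem cost_cell [Field F] (h : SizeBounded size D s) (a : ℕ) (i j : NatExpr) :
    (ValExpr.cell a i j).cost size s ≤ i.cost s + j.cost s + (D + 1) := by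
  have := h.2.2 a (i.eval s) (j.eval s)
  simp only [ValExpr.cost, ValExpr.eval]
  omega

end SizeBounded

theorem State.setVal_eq_self (s : State F) (a i j : ℕ) : s.setVal a i j (s.farr a i j) = s := by
  simp only [State.setVal]
  congr
  funext a' i' j'
  split_ifs with h
  · obtain ⟨rfl, rfl, rfl⟩ := h; rfl
  · rfl

end Memory

section Machine

variable {F : Type*} [Field F] [LinearOrder F] {size : F → ℕ}

/-- Started in `s`, the program `c` halts at cost at most `T` in a state that satisfies `Q`. -/
def Runs (size : F → ℕ) (c : Prog) (s : State F) (T : ℕ) (Q : State F → Prop) : Prop :=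
  ∃ s' t, Exec size c s s' t ∧ t ≤ T ∧ Q s'

theorem Runs.mono {c : Prog} {s : State F} {T T' : ℕ} {Q Q' : State F → Prop}
    (h : Runs size c s T Q) (hT : T ≤ T') (hQ : ∀ s', Q s' → Q' s') : Runs size c s T' Q' :=
  let ⟨s', t, he, ht, hq⟩ := h
  ⟨s', t, he, ht.trans hT, hQ s' hq⟩

theorem Runs.seq {c₁ c₂ : Prog} {s : State F} {T₁ T₂ : ℕ} {Q R : State F → Prop}
    (h₁ : Runs size c₁ s T₁ Q) (h₂ : ∀ s', Q s' → Runs size c₂ s' T₂ R) :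
    Runs size (.seq c₁ c₂) s (T₁ + T₂ + 1) R := by
  obtain ⟨s', t, he, ht, hq⟩ := h₁
  obtain ⟨s'', t', he', ht', hr⟩ := h₂ s' hq
  exact ⟨s'', _, .seq he he', by omega, hr⟩

theorem Runs.ite {b : Test} {c₁ c₂ : Prog} {s : State F} {C T : ℕ} {Q : State F → Prop}
    (hb : b.cost size s ≤ C) (h₁ : b.eval s = true → Runs size c₁ s T Q)
    (h₂ : b.eval s = false → Runs size c₂ s T Q) : Runs size (.ite b c₁ c₂) s (C + T + 1) Q := by
  cases hv : b.eval s
  · obtain ⟨s', t, he, ht, hq⟩ := h₂ hv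
    exact ⟨s', _, .iteFalse hv he, by omega, hq⟩
  · obtain ⟨s', t, he, ht, hq⟩ := h₁ hv
    exact ⟨s', _, .iteTrue hv he, by omega, hq⟩

/-- The invariant `I k` holds after `k` of the `N` iterations of a loop. -/
theorem Runs.while {b : Test} {c : Prog} {C T N : ℕ} {I : ℕ → State F → Prop}
    (hstep : ∀ k s, k < N → I k s →
      b.eval s = true ∧ b.cost size s ≤ C ∧ Runs size c s T (I (k + 1)))
    (hend : ∀ s, I N s → b.eval s = false ∧ b.cost size s ≤ C) {s : State F} (h : I 0 s) :
    Runs size (.while b c) s (N * (C + T + 1) + C + 1) (I N) := by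
  suffices H : ∀ r k s, k + r = N → I k s →
      Runs size (.while b c) s (r * (C + T + 1) + C + 1) (I N) from H N 0 s (by omega) h
  intro r
  induction r with
  | zero =>
    intro k s hk h
    obtain rfl : k = N := by omega
    obtain ⟨hb, hc⟩ := hend s h
    exact ⟨s, _, .whileFalse hb, by omega, h⟩
  | succ r ih =>
    intro k s hk h
    obtain ⟨hb, hc, s', t, he, ht, hi⟩ := hstep k s (by omega) h
    obtain ⟨s'', t', he', ht', hi'⟩ := ih (k + 1) s' (by omega) hi
    exact ⟨s'', _, .whileTrue hb he he', by rw [Nat.succ_mul]; omega, hi'⟩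

/-- The loop `for (x := 0; b; x := x + 1) c`. -/
def Prog.forLoop (x : ℕ) (b : Test) (c : Prog) : Prog :=
  .seq (.setVar x (.const 0)) (.while b (.seq c (.setVar x (.add (.var x) (.const 1)))))

theorem Runs.forLoop {x : ℕ} {b : Test} {c : Prog} {C T N D : ℕ} {I : ℕ → State F → Prop}
    (hN : N.size ≤ D)
    (hstep : ∀ k s, k < N → I k s → b.eval s = true ∧ b.cost size s ≤ C ∧
      Runs size c s T fun s' => s'.nvar x = k ∧ I (k + 1) (s'.setVar x (k + 1)))
    (hend : ∀ s, I N s → b.eval s = false ∧ b.cost size s ≤ C) {s : State F}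
    (h : I 0 (s.setVar x 0)) :
    Runs size (Prog.forLoop x b c) s ((N + 1) * (C + T + 2 * D + 7)) (I N) := by
  have h1 : Runs size (.setVar x (.const 0)) s 2 (I 0) :=
    ⟨_, _, .setVar s x (.const 0), by simp [NatExpr.cost], h⟩
  refine (h1.seq fun s' h' => Runs.while (T := T + (2 * D + 5) + 1) (C := C) ?_ hend h').mono ?_
    fun _ => id
  · intro k s hk hi
    obtain ⟨hb, hc, hr⟩ := hstep k s hk hi
    refine ⟨hb, hc, hr.seq fun s' ⟨hx, hi'⟩ => ⟨_, _, .setVar s' x _, ?_, ?_⟩⟩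
    · have h2 : k.size ≤ D := (Nat.size_le_size hk.le).trans hN
      have h3 : (k + 1).size ≤ D := (Nat.size_le_size hk).trans hN
      simp only [NatExpr.cost, NatExpr.eval, hx, Nat.size_one]
      omega
    · simpa only [NatExpr.eval, hx] using hi'
  · rw [Nat.succ_mul N]
    have : N * (C + (T + (2 * D + 5) + 1) + 1) = N * (C + T + 2 * D + 7) := by ring
    omega

theorem Runs.setVal {a : ℕ} {i j : NatExpr} {e : ValExpr} {s : State F} {T : ℕ} {z : F}
    (hT : i.cost s + j.cost s + e.cost size s + 1 ≤ T) (hz : e.eval s = z) :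
    Runs size (.setVal a i j e) s T (· = s.setVal a (i.eval s) (j.eval s) z) :=
  ⟨_, _, .setVal s a i j e, hT, by rw [hz]⟩

theorem Runs.skip_setVal {a i j : ℕ} {s : State F} {T : ℕ} {z : F} (hT : 1 ≤ T)
    (hz : s.farr a i j = z) : Runs size .skip s T (· = s.setVal a i j z) :=
  ⟨_, _, .skip s, hT, by rw [← hz, State.setVal_eq_self]⟩

end Machine

/-! ### The program -/

section Program

variable {F : Type*} [LinearOrder F]

/-- The weight matrix of the complete graph in which a pair that is not an edge gets the bottleneck
cost of the path through the root; the input is read from the arrays with number `0`. -/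
def completion (s : State F) (i j : ℕ) : F :=
  if s.narr 0 i j = 0 then max (s.farr 0 i 0) (s.farr 0 0 j) else s.farr 0 i j

/-- Write the completed weight of the pair `(1), (2)` to array `2`. -/
def completionStep : Prog :=
  .ite (.natEq (.cell 0 (.var 1) (.var 2)) (.const 0))
    (.ite (.valLT (.cell 0 (.var 1) (.const 0)) (.cell 0 (.const 0) (.var 2)))
      (.setVal 2 (.var 1) (.var 2) (.cell 0 (.const 0) (.var 2)))
      (.setVal 2 (.var 1) (.var 2) (.cell 0 (.var 1) (.const 0))))
    (.setVal 2 (.var 1) (.var 2) (.cell 0 (.var 1) (.var 2)))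

/-- Write the completed weight matrix to array `2`. -/
def completionProg : Prog :=
  .forLoop 1 (.not (.natLT (.var 0) (.var 1)))
    (.forLoop 2 (.not (.natLT (.var 0) (.var 2))) completionStep)

/-- Lower the payment of the vertex `(0)` to the weight of its edge to `(1)`. -/
def paymentStep : Prog :=
  .ite (.valLT (.cell 2 (.var 0) (.var 1)) (.cell 1 (.sub (.var 0) (.const 1)) (.const 0)))
    (.setVal 1 (.sub (.var 0) (.const 1)) (.const 0) (.cell 2 (.var 0) (.var 1)))
    .skip

/-- Update the weight of the pair `(1), (2)` for the elimination of the vertex `(0)`. -/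
def eliminationStep : Prog :=
  .ite (.and (.valLT (.cell 2 (.var 1) (.var 0)) (.cell 2 (.var 1) (.var 2)))
      (.valLT (.cell 2 (.var 0) (.var 2)) (.cell 2 (.var 1) (.var 2))))
    (.ite (.valLT (.cell 2 (.var 1) (.var 0)) (.cell 2 (.var 0) (.var 2)))
      (.setVal 2 (.var 1) (.var 2) (.cell 2 (.var 0) (.var 2)))
      (.setVal 2 (.var 1) (.var 2) (.cell 2 (.var 1) (.var 0))))
    .skip

/-- Process the last vertex `(0)`: compute its payment, eliminate it, and pass to the vertex
before. -/
def vertexProg : Prog :=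
  .seq (.setVal 1 (.sub (.var 0) (.const 1)) (.const 0) (.cell 2 (.var 0) (.const 0)))
    (.seq
      (.forLoop 1 (.natLT (.var 1) (.var 0))
        (.seq paymentStep (.forLoop 2 (.natLT (.var 2) (.var 0)) eliminationStep)))
      (.setVar 0 (.sub (.var 0) (.const 1))))

/-- The allocation program. -/
def allocationProg : Prog :=
  .seq completionProg (.while (.natLT (.const 0) (.var 0)) vertexProg)

end Program

section Correctness

variable {F : Type*} [Field F] [LinearOrder F] {size : F → ℕ} {D : ℕ}

theorem runs_completionStep {s : State F} (hs : SizeBounded size D s) :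
    Runs size completionStep s (20 * (D + 1))
      (· = s.setVal 2 (s.nvar 1) (s.nvar 2) (completion s (s.nvar 1) (s.nvar 2))) := by
  have h1 := hs.cost_var 1
  have h2 := hs.cost_var 2
  have h0 : (NatExpr.const 0).cost s = 1 := rfl
  have c1 := hs.cost_cell 0 (.var 1) (.const 0)
  have c2 := hs.cost_cell 0 (.const 0) (.var 2)
  have c3 := hs.cost_cell 0 (.var 1) (.var 2)
  have c4 := hs.cost_natCell 0 (.var 1) (.var 2)
  refine (Runs.ite (C := 3 * (D + 1) + 2) (T := 14 * (D + 1)) ?_ (fun ht => ?_) fun hf => ?_).mono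
    (by omega) fun _ => id
  · simp only [Test.cost]; omega
  · have hz : s.narr 0 (s.nvar 1) (s.nvar 2) = 0 :=
      of_decide_eq_true ht
    refine (Runs.ite (C := 4 * (D + 1) + 3) (T := 5 * (D + 1) + 1) ?_ (fun ht => ?_)
      fun hf => ?_).mono (by omega) fun _ => id
    · simp only [Test.cost]; omega
    · have hlt : s.farr 0 (s.nvar 1) 0 < s.farr 0 0 (s.nvar 2) :=
        of_decide_eq_true ht
      refine Runs.setVal (by omega) ?_
      rw [completion, if_pos hz, max_eq_right hlt.le]; rfl
    · have hle : s.farr 0 0 (s.nvar 2) ≤ s.farr 0 (s.nvar 1) 0 :=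
        not_lt.mp (of_decide_eq_false hf)
      refine Runs.setVal (by omega) ?_
      rw [completion, if_pos hz, max_eq_left hle]; rfl
  · have hz : s.narr 0 (s.nvar 1) (s.nvar 2) ≠ 0 :=
      of_decide_eq_false hf
    refine Runs.setVal (by omega) ?_
    rw [completion, if_neg hz]; rfl

theorem runs_paymentStep {s : State F} (hs : SizeBounded size D s) :
    Runs size paymentStep s (20 * (D + 1))
      (· = s.setVal 1 (s.nvar 0 - 1) 0
        (min (s.farr 1 (s.nvar 0 - 1) 0) (s.farr 2 (s.nvar 0) (s.nvar 1)))) := by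
  have h0 := hs.cost_var 0
  have h1 := hs.cost_var 1
  have hc : (NatExpr.const 0).cost s = 1 := rfl
  have hp := hs.cost_pred 0
  have c1 := hs.cost_cell 2 (.var 0) (.var 1)
  have c2 := hs.cost_cell 1 (.sub (.var 0) (.const 1)) (.const 0)
  refine (Runs.ite (C := 6 * (D + 1) + 4) (T := 5 * (D + 1) + 4) ?_ (fun ht => ?_)
    fun hf => ?_).mono (by omega) fun _ => id
  · simp only [Test.cost]; omega
  · have hlt : s.farr 2 (s.nvar 0) (s.nvar 1) < s.farr 1 (s.nvar 0 - 1) 0 :=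
      of_decide_eq_true ht
    exact Runs.setVal (by omega) (min_eq_right hlt.le).symm
  · have hle : s.farr 1 (s.nvar 0 - 1) 0 ≤ s.farr 2 (s.nvar 0) (s.nvar 1) :=
      not_lt.mp (of_decide_eq_false hf)
    exact Runs.skip_setVal (by omega) (min_eq_left hle).symm

theorem runs_eliminationStep {s : State F} (hs : SizeBounded size D s) :
    Runs size eliminationStep s (40 * (D + 1))
      (· = s.setVal 2 (s.nvar 1) (s.nvar 2)
        (eliminate (s.nvar 0) (s.farr 2) (s.nvar 1) (s.nvar 2))) := by
  have h0 := hs.cost_var 0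
  have h1 := hs.cost_var 1
  have h2 := hs.cost_var 2
  have c1 := hs.cost_cell 2 (.var 1) (.var 0)
  have c2 := hs.cost_cell 2 (.var 0) (.var 2)
  have c3 := hs.cost_cell 2 (.var 1) (.var 2)
  refine (Runs.ite (C := 12 * (D + 1) + 3) (T := 12 * (D + 1) + 3) ?_ (fun ht => ?_)
    fun hf => ?_).mono (by omega) fun _ => id
  · simp only [Test.cost]; omega
  · have hlt : s.farr 2 (s.nvar 1) (s.nvar 0) < s.farr 2 (s.nvar 1) (s.nvar 2) ∧
        s.farr 2 (s.nvar 0) (s.nvar 2) < s.farr 2 (s.nvar 1) (s.nvar 2) :=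
      (Bool.and_eq_true_iff.mp ht).imp of_decide_eq_true of_decide_eq_true
    have he := min_eq_right (max_lt hlt.1 hlt.2).le
    refine (Runs.ite (C := 6 * (D + 1) + 1) (T := 5 * (D + 1) + 1) ?_ (fun ht => ?_)
      fun hf => ?_).mono (by omega) fun _ => id
    · simp only [Test.cost]; omega
    · have hlt' : s.farr 2 (s.nvar 1) (s.nvar 0) < s.farr 2 (s.nvar 0) (s.nvar 2) :=
        of_decide_eq_true ht
      refine Runs.setVal (by omega) ?_
      rw [eliminate, he, max_eq_right hlt'.le]; rfl
    · have hle : s.farr 2 (s.nvar 0) (s.nvar 2) ≤ s.farr 2 (s.nvar 1) (s.nvar 0) :=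
        not_lt.mp (of_decide_eq_false hf)
      refine Runs.setVal (by omega) ?_
      rw [eliminate, he, max_eq_left hle]; rfl
  · have hle : s.farr 2 (s.nvar 1) (s.nvar 0) < s.farr 2 (s.nvar 1) (s.nvar 2) →
        s.farr 2 (s.nvar 1) (s.nvar 2) ≤ s.farr 2 (s.nvar 0) (s.nvar 2) :=
      fun h => not_lt.mp fun h' => Bool.false_ne_true (hf.symm.trans
        (Bool.and_eq_true_iff.mpr ⟨decide_eq_true h, decide_eq_true h'⟩))
    refine Runs.skip_setVal (by omega) (min_eq_left (le_max_iff.mpr ?_)).symm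
    by_cases h : s.farr 2 (s.nvar 1) (s.nvar 0) < s.farr 2 (s.nvar 1) (s.nvar 2)
    · exact .inr (hle h)
    · exact .inl (not_lt.mp h)

theorem runs_completionProg {n : ℕ} (hn : (n + 1).size ≤ D) (hD : n + 2 ≤ D + 1) {s₀ : State F}
    (hs : SizeBounded size D s₀) (h0 : s₀.nvar 0 = n) :
    Runs size completionProg s₀ (40 * (D + 1) ^ 3) fun s => SizeBounded size D s ∧ s.nvar 0 = n ∧
      ∀ a ≤ n, ∀ b ≤ n, s.farr 2 a b = completion s₀ a b := by
  have hcomp : ∀ s : State F, s.narr = s₀.narr → s.farr 0 = s₀.farr 0 →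
      completion s = completion s₀ := by
    intro s h1 h2
    funext a b
    rw [completion, completion, h1, h2]
  have hle : ∀ k ≤ n + 1, k.size ≤ D := fun k hk => (Nat.size_le_size hk).trans hn
  have htest : ∀ (s : State F) (x k : ℕ), SizeBounded size D s → s.nvar 0 = n → s.nvar x = k →
      ((Test.not (.natLT (.var 0) (.var x))).eval s = decide (k ≤ n)) ∧
      (Test.not (.natLT (.var 0) (.var x))).cost size s ≤ 2 * (D + 1) + 2 := by
    intro s x k hs h0 hx
    have h1 := hs.cost_var 0
    have h2 := hs.cost_var x
    refine ⟨?_, by simp only [Test.cost]; omega⟩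
    rw [Bool.eq_iff_iff]
    simp [Test.eval, NatExpr.eval, h0, hx]
  -- Rows before `i` and the first `j` entries of row `i` are done.
  let J : ℕ → ℕ → State F → Prop := fun i j s => SizeBounded size D s ∧ s.nvar 0 = n ∧
    s.nvar 1 = i ∧ s.narr = s₀.narr ∧ s.farr 0 = s₀.farr 0 ∧
    ∀ a b, b ≤ n → (a < i ∨ a = i ∧ b < j) → s.farr 2 a b = completion s₀ a b
  have inner : ∀ i s, i ≤ n → J i 0 s →
      Runs size (.forLoop 2 (.not (.natLT (.var 0) (.var 2))) completionStep) s
        (31 * (D + 1) ^ 2) (J i (n + 1)) := by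
    intro i s hi hJ
    refine (Runs.forLoop (I := fun j s => J i j s ∧ s.nvar 2 = j) (N := n + 1) (D := D)
      (C := 2 * (D + 1) + 2) (T := 20 * (D + 1)) hn ?_ ?_ ?_).mono ?_ fun _ => And.left
    · rintro j s hj ⟨⟨hs, h0, h1, hna, hfa, hdone⟩, h2⟩
      obtain ⟨hev, hco⟩ := htest s 2 j hs h0 h2
      refine ⟨by rw [hev]; simpa using by omega, hco,
        (runs_completionStep hs).mono le_rfl ?_⟩
      rintro s' rfl
      rw [h1, h2, hcomp s hna hfa]
      refine ⟨h2, ⟨?_, ?_, ?_, hna, ?_, ?_⟩, ?_⟩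
      · refine (hs.setVal _ _ _ ?_).setVar 2 (hle _ (by omega))
        rw [← hcomp s hna hfa, completion]
        split_ifs
        · exact size_max_le (hs.2.2 _ _ _) (hs.2.2 _ _ _)
        · exact hs.2.2 _ _ _
      · simpa [State.setVar, State.setVal] using h0
      · simpa [State.setVar, State.setVal] using h1
      · funext a b
        simp [State.setVar, State.setVal, hfa]
      · intro a b hb hab
        simp only [State.setVar, State.setVal, true_and]
        split_ifs with h
        · rw [h.1, h.2]
        · exact hdone a b hb (by omega)
      · simp [State.setVar]
    · rintro s ⟨⟨hs, h0, -⟩, h2⟩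
      obtain ⟨hev, hco⟩ := htest s 2 _ hs h0 h2
      exact ⟨by rw [hev]; simp, hco⟩
    · obtain ⟨hs, h0, h1, hna, hfa, hdone⟩ := hJ
      refine ⟨⟨hs.setVar 2 (hle 0 (by omega)), ?_, ?_, hna, hfa, hdone⟩, ?_⟩ <;>
        simp [State.setVar, h0, h1]
    · calc (n + 1 + 1) * (2 * (D + 1) + 2 + 20 * (D + 1) + 2 * D + 7)
          ≤ (D + 1) * (31 * (D + 1)) := Nat.mul_le_mul hD (by omega)
        _ = 31 * (D + 1) ^ 2 := by ring
  refine (Runs.forLoop (I := fun i s => J i 0 s) (N := n + 1) (D := D)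
    (C := 2 * (D + 1) + 2) (T := 31 * (D + 1) ^ 2) hn ?_ ?_ ?_).mono ?_ ?_
  · rintro i s hi hJ
    obtain ⟨hev, hco⟩ := htest s 1 i hJ.1 hJ.2.1 hJ.2.2.1
    refine ⟨by rw [hev]; simpa using by omega, hco,
      (inner i s (by omega) hJ).mono le_rfl ?_⟩
    rintro s' ⟨hs, h0, h1, hna, hfa, hdone⟩
    refine ⟨h1, hs.setVar 1 (hle _ (by omega)), ?_, ?_, hna, hfa, fun a b hb hab =>
      hdone a b hb (by omega)⟩ <;> simp [State.setVar, h0]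
  · rintro s ⟨hs, h0, h1, -⟩
    obtain ⟨hev, hco⟩ := htest s 1 _ hs h0 h1
    exact ⟨by rw [hev]; simp, hco⟩
  · refine ⟨hs.setVar 1 (hle 0 (by omega)), ?_, ?_, rfl, rfl, fun a b _ h => ?_⟩
    · simp [State.setVar, h0]
    · simp [State.setVar]
    · omega
  · calc (n + 1 + 1) * (2 * (D + 1) + 2 + 31 * (D + 1) ^ 2 + 2 * D + 7)
        ≤ (D + 1) * (40 * (D + 1) ^ 2) := Nat.mul_le_mul hD (by nlinarith)
      _ = 40 * (D + 1) ^ 3 := by ring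
  · rintro s ⟨hs, h0, -, -, -, hdone⟩
    exact ⟨hs, h0, fun a ha b hb => hdone a b hb (by omega)⟩

/-- One round of the main loop: the payment of the last vertex `m + 1` is stored in row `m` of the
output, the other outputs are kept, and the weights of the pairs of smaller vertices are updated. -/
theorem runs_vertexProg {m : ℕ} (hm : (m + 1).size ≤ D) (hD : m + 2 ≤ D + 1) {s₀ : State F}
    (hs : SizeBounded size D s₀) (h0 : s₀.nvar 0 = m + 1) :
    Runs size vertexProg s₀ (110 * (D + 1) ^ 3) fun s => SizeBounded size D s ∧ s.nvar 0 = m ∧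
      s.farr 1 m 0 = prefixMin (s₀.farr 2 (m + 1)) (m + 1) ∧
      (∀ a, a ≠ m → s.farr 1 a 0 = s₀.farr 1 a 0) ∧
      ∀ a ≤ m, ∀ b ≤ m, s.farr 2 a b = eliminate (m + 1) (s₀.farr 2) a b := by
  have hle : ∀ k ≤ m + 1, k.size ≤ D := fun k hk => (Nat.size_le_size hk).trans hm
  have htest : ∀ (s : State F) (x k : ℕ), SizeBounded size D s → s.nvar 0 = m + 1 → s.nvar x = k →
      ((Test.natLT (.var x) (.var 0)).eval s = decide (k < m + 1)) ∧
      (Test.natLT (.var x) (.var 0)).cost size s ≤ 2 * (D + 1) + 1 := by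
    intro s x k hs h0 hx
    have h1 := hs.cost_var 0
    have h2 := hs.cost_var x
    exact ⟨by simp [Test.eval, NatExpr.eval, h0, hx], by simp only [Test.cost]; omega⟩
  -- `p` edges of the last vertex have been compared, rows before `i` and the first `j` entries of
  -- row `i` have been updated. The row and the column of the last vertex do not change.
  let J : ℕ → ℕ → ℕ → State F → Prop := fun p i j s => SizeBounded size D s ∧ s.nvar 0 = m + 1 ∧
    s.nvar 1 = i ∧ s.farr 1 m 0 = prefixMin (s₀.farr 2 (m + 1)) p ∧
    (∀ a, a ≠ m → s.farr 1 a 0 = s₀.farr 1 a 0) ∧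
    ∀ a b, s.farr 2 a b = if b ≤ m ∧ (a < i ∨ a = i ∧ b < j)
      then eliminate (m + 1) (s₀.farr 2) a b else s₀.farr 2 a b
  have inner : ∀ p i s, i ≤ m → J p i 0 s →
      Runs size (.forLoop 2 (.natLT (.var 2) (.var 0)) eliminationStep) s
        (51 * (D + 1) ^ 2) (J p i (m + 1)) := by
    intro p i s hi hJ
    refine (Runs.forLoop (I := fun j s => J p i j s ∧ s.nvar 2 = j) (N := m + 1) (D := D)
      (C := 2 * (D + 1) + 1) (T := 40 * (D + 1)) hm ?_ ?_ ?_).mono ?_ fun _ => And.left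
    · rintro j s hj ⟨⟨hs, h0, h1, hmin, hout, hW⟩, h2⟩
      obtain ⟨hev, hco⟩ := htest s 2 j hs h0 h2
      refine ⟨by rw [hev]; simpa using by omega, hco,
        (runs_eliminationStep hs).mono le_rfl ?_⟩
      rintro s' rfl
      have hval : eliminate (m + 1) (s.farr 2) i j = eliminate (m + 1) (s₀.farr 2) i j := by
        rw [eliminate, eliminate, hW i j, hW i (m + 1), hW (m + 1) j, if_neg (by omega),
          if_neg (by omega), if_neg (by omega)]
      rw [h0, h1, h2]
      refine ⟨h2, ⟨?_, ?_, ?_, ?_, ?_, ?_⟩, ?_⟩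
      · exact (hs.setVal _ _ _ (size_min_le (hs.2.2 _ _ _)
          (size_max_le (hs.2.2 _ _ _) (hs.2.2 _ _ _)))).setVar 2 (hle _ (by omega))
      · simpa [State.setVar, State.setVal] using h0
      · simpa [State.setVar, State.setVal] using h1
      · simpa [State.setVar, State.setVal] using hmin
      · simpa [State.setVar, State.setVal] using hout
      · intro a b
        simp only [State.setVar, State.setVal, true_and]
        by_cases h : a = i ∧ b = j
        · rw [if_pos h, h.1, h.2, hval, if_pos (by omega)]
        · rw [if_neg h, hW a b]
          congr 1
          apply propext
          omega
      · simp [State.setVar]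
    · rintro s ⟨⟨hs, h0, -⟩, h2⟩
      obtain ⟨hev, hco⟩ := htest s 2 _ hs h0 h2
      exact ⟨by rw [hev]; simp, hco⟩
    · obtain ⟨hs, h0, h1, hmin, hout, hW⟩ := hJ
      refine ⟨⟨hs.setVar 2 (hle 0 (by omega)), ?_, ?_, hmin, hout, hW⟩, ?_⟩ <;>
        simp [State.setVar, h0, h1]
    · calc (m + 1 + 1) * (2 * (D + 1) + 1 + 40 * (D + 1) + 2 * D + 7)
          ≤ (D + 1) * (51 * (D + 1)) := Nat.mul_le_mul hD (by omega)
        _ = 51 * (D + 1) ^ 2 := by ring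
  have outer : ∀ s, J 0 0 0 (s.setVar 1 0) →
      Runs size (.forLoop 1 (.natLT (.var 1) (.var 0))
        (.seq paymentStep (.forLoop 2 (.natLT (.var 2) (.var 0)) eliminationStep))) s
        (90 * (D + 1) ^ 3) (J (m + 1) (m + 1) 0) := by
    intro s hJ
    refine (Runs.forLoop (I := fun i s => J i i 0 s) (N := m + 1) (D := D)
      (C := 2 * (D + 1) + 1) (T := 20 * (D + 1) + 51 * (D + 1) ^ 2 + 1) hm ?_ ?_ hJ).mono ?_
      fun _ => id
    · rintro i s hi ⟨hs, h0, h1, hmin, hout, hW⟩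
      obtain ⟨hev, hco⟩ := htest s 1 i hs h0 h1
      refine ⟨by rw [hev]; simpa using by omega, hco,
        ((runs_paymentStep hs).seq (R := J (i + 1) i (m + 1)) ?_).mono le_rfl ?_⟩
      · rintro s' rfl
        refine inner (i + 1) i _ (by omega) ⟨?_, ?_, ?_, ?_, ?_, ?_⟩
        · exact hs.setVal _ _ _ (size_min_le (hs.2.2 _ _ _) (hs.2.2 _ _ _))
        · simpa [State.setVal] using h0
        · simpa [State.setVal] using h1
        · rw [prefixMin]
          have hi' : s.farr 2 (m + 1) i = s₀.farr 2 (m + 1) i := by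
            rw [hW, if_neg (by omega)]
          simp [State.setVal, h0, h1, hmin, hi']
        · intro a ha
          simpa [State.setVal, h0, ha] using hout a ha
        · simpa [State.setVal] using hW
      · rintro s' ⟨hs, h0, h1, hmin, hout, hW⟩
        refine ⟨h1, hs.setVar 1 (hle _ (by omega)), ?_, ?_, hmin, hout, fun a b =>
          (hW a b).trans ?_⟩
        · simp [State.setVar, h0]
        · simp [State.setVar]
        · congr 1
          apply propext
          omega
    · rintro s ⟨hs, h0, h1, -⟩
      obtain ⟨hev, hco⟩ := htest s 1 _ hs h0 h1
      exact ⟨by rw [hev]; simp, hco⟩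
    · calc (m + 1 + 1) * (2 * (D + 1) + 1 + (20 * (D + 1) + 51 * (D + 1) ^ 2 + 1) + 2 * D + 7)
          ≤ (D + 1) * (90 * (D + 1) ^ 2) := Nat.mul_le_mul hD (by nlinarith)
        _ = 90 * (D + 1) ^ 3 := by ring
  have c0 := hs.cost_var 0
  have c1 := hs.cost_cell 2 (.var 0) (.const 0)
  have cc : (NatExpr.const 0).cost s₀ = 1 := rfl
  have cp := hs.cost_pred 0
  have first : Runs size (.setVal 1 (.sub (.var 0) (.const 1)) (.const 0)
      (.cell 2 (.var 0) (.const 0))) s₀ (5 * (D + 1) + 3)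
      (· = s₀.setVal 1 m 0 (s₀.farr 2 (m + 1) 0)) := by
    refine (Runs.setVal (z := s₀.farr 2 (m + 1) 0) (T := 5 * (D + 1) + 3) (by omega) ?_).mono
      le_rfl ?_
    · simp [ValExpr.eval, NatExpr.eval, h0]
    · rintro s rfl
      simp [NatExpr.eval, h0]
  refine (first.seq fun s hs' => (outer s ?_).seq (R := fun s => SizeBounded size D s ∧
      s.nvar 0 = m ∧ s.farr 1 m 0 = prefixMin (s₀.farr 2 (m + 1)) (m + 1) ∧
      (∀ a, a ≠ m → s.farr 1 a 0 = s₀.farr 1 a 0) ∧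
      ∀ a ≤ m, ∀ b ≤ m, s.farr 2 a b = eliminate (m + 1) (s₀.farr 2) a b)
      (T₂ := 2 * (D + 1) + 3) ?_).mono ?_ fun _ => id
  · subst hs'
    refine ⟨(hs.setVal _ _ _ (hs.2.2 _ _ _)).setVar 1 (hle 0 (by omega)), ?_, ?_, ?_, ?_, ?_⟩
    · simpa [State.setVar, State.setVal] using h0
    · simp [State.setVar]
    · simp [State.setVar, State.setVal, prefixMin]
    · intro a ha
      simp [State.setVar, State.setVal, ha]
    · intro a b
      simp [State.setVar, State.setVal]
  · rintro s' ⟨hs', h0', -, hmin, hout, hW⟩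
    refine ⟨_, _, .setVar s' 0 _, ?_, ?_⟩
    · have := hs'.cost_pred 0
      omega
    · have he : (NatExpr.sub (.var 0) (.const 1)).eval s' = m := by simp [NatExpr.eval, h0']
      rw [he]
      refine ⟨hs'.setVar 0 (hle m (by omega)), by simp [State.setVar], hmin, hout, ?_⟩
      intro a ha b hb
      rw [show (s'.setVar 0 m).farr 2 a b = s'.farr 2 a b from rfl, hW a b, if_pos (by omega)]
  · have : (D + 1) ≤ (D + 1) ^ 3 := Nat.le_self_pow (by norm_num) _
    omega

/-- The program computes the allocation of the completed weight matrix. -/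
theorem runs_allocationProg {n : ℕ} (hn : (n + 1).size ≤ D) (hD : n + 2 ≤ D + 1) {s₀ : State F}
    (hs : SizeBounded size D s₀) (h0 : s₀.nvar 0 = n) :
    Runs size allocationProg s₀ (200 * (D + 1) ^ 4) fun s =>
      ∀ v < n, s.farr 1 v 0 = allocate n (completion s₀) (v + 1) := by
  have hle : ∀ k ≤ n + 1, k.size ≤ D := fun k hk => (Nat.size_le_size hk).trans hn
  -- After `k` rounds, the payments of the last `k` vertices are known, and those of the others are
  -- the allocation of the current matrix.
  let I : ℕ → State F → Prop := fun k s => SizeBounded size D s ∧ s.nvar 0 = n - k ∧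
    (∀ v, n - k ≤ v → v < n → s.farr 1 v 0 = allocate n (completion s₀) (v + 1)) ∧
    ∀ v < n - k, allocate (n - k) (s.farr 2) (v + 1) = allocate n (completion s₀) (v + 1)
  have htest : ∀ s k, I k s → ((Test.natLT (.const 0) (.var 0)).eval s = decide (k < n)) ∧
      (Test.natLT (.const 0) (.var 0)).cost size s ≤ (D + 1) + 2 := by
    rintro s k ⟨hs, h0, -⟩
    have h1 := hs.cost_var 0
    have h2 : (NatExpr.const 0).cost s = 1 := rfl
    refine ⟨?_, by simp only [Test.cost]; omega⟩
    rw [Bool.eq_iff_iff]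
    simp [Test.eval, NatExpr.eval, h0]
  refine ((runs_completionProg hn hD hs h0).seq fun s hs' => Runs.while (I := I) (N := n)
    (C := (D + 1) + 2) (T := 110 * (D + 1) ^ 3) ?_ ?_ ?_).mono ?_ ?_
  · intro k s hk hI
    obtain ⟨hev, hco⟩ := htest s k hI
    refine ⟨by rw [hev]; simpa using hk, hco, ?_⟩
    obtain ⟨hs, h0, hdone, hrest⟩ := hI
    obtain ⟨m, hm⟩ : ∃ m, n - k = m + 1 := ⟨n - k - 1, by omega⟩
    have hm' : n - (k + 1) = m := by omega
    rw [hm] at h0 hdone hrest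
    refine (runs_vertexProg (hle _ (by omega)) (by omega) hs h0).mono le_rfl ?_
    rintro s' ⟨hs', h0', hlast, hout, hW⟩
    refine ⟨hs', by rw [h0', hm'], fun v hv hvn => ?_, fun v hv => ?_⟩
    · rcases eq_or_ne v m with rfl | hvm
      · rw [hlast, ← allocate_last, hrest v (by omega)]
      · rw [hout v hvm, hdone v (by omega) hvn]
    · rw [hm'] at hv ⊢
      rw [allocate_congr hW, ← allocate_of_ne (s.farr 2) (by omega), hrest v (by omega)]
  · intro s hI
    obtain ⟨hev, hco⟩ := htest s n hI
    exact ⟨by rw [hev]; simp, hco⟩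
  · obtain ⟨hs, h0, hW⟩ := hs'
    exact ⟨hs, h0, fun v hv hvn => by omega, fun v hv => allocate_congr hW _⟩
  · have h1 : n * ((D + 1) + 2 + 110 * (D + 1) ^ 3 + 1) ≤ (D + 1) * (114 * (D + 1) ^ 3) := by
      have : (D + 1) ≤ (D + 1) ^ 3 := Nat.le_self_pow (by norm_num) _
      exact Nat.mul_le_mul (by omega) (by omega)
    have h2 : (D + 1) * (114 * (D + 1) ^ 3) = 114 * (D + 1) ^ 4 := by ring
    have h3 : (D + 1) ^ 3 ≤ (D + 1) ^ 4 := Nat.pow_le_pow_right (by omega) (by norm_num)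
    have h4 : (D + 1) ≤ (D + 1) ^ 4 := Nat.le_self_pow (by norm_num) _
    omega
  · rintro s ⟨-, -, hdone, -⟩ v hv
    exact hdone v (by omega) hv

end Correctness

/-! ### The input of the program -/

section Input

variable {n : ℕ}

theorem vertexIndex_injective : Function.Injective (vertexIndex (n := n)) := by
  rintro (_ | i) (_ | j) h <;> simp only [vertexIndex] at h
  · rfl
  · omega
  · omega
  · rw [Fin.ext (by omega : (i : ℕ) = j)]

/-- The vertex at a position of the adjacency matrix; positions out of range give the root. -/
def vertexAt (n k : ℕ) : Option (Fin n) :=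
  if h : 1 ≤ k ∧ k ≤ n then some ⟨k - 1, by omega⟩ else none

theorem vertexIndex_vertexAt {k : ℕ} (h : k ≤ n) : vertexIndex (vertexAt n k) = k := by
  rw [vertexAt]
  split_ifs with h'
  · simp only [vertexIndex]; omega
  · simp only [vertexIndex]; omega

theorem vertexAt_vertexIndex (a : Option (Fin n)) : vertexAt n (vertexIndex a) = a := by
  cases a with
  | none => simp [vertexAt, vertexIndex]
  | some i => simp [vertexAt, vertexIndex, Nat.succ_le_iff.mpr i.isLt]

theorem vertexIndex_le (a : Option (Fin n)) : vertexIndex a ≤ n := by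
  cases a with
  | none => exact Nat.zero_le _
  | some i => exact i.isLt

variable {F : Type*} [Field F] (G : SimpleGraph (Option (Fin n))) (w : G.edgeSet → F)

theorem map_vertexIndex_eq_iff {e : Sym2 (Option (Fin n))} {a b : Option (Fin n)} :
    Sym2.map vertexIndex e = s(vertexIndex a, vertexIndex b) ↔ e = s(a, b) := by
  rw [← Sym2.map_mk, (Sym2.map.injective vertexIndex_injective).eq_iff]

theorem narr_inputState_ne_zero_iff {a b : Option (Fin n)} :
    (inputState G w).narr 0 (vertexIndex a) (vertexIndex b) ≠ 0 ↔ G.Adj a b := by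
  have h : s(vertexIndex a, vertexIndex b) ∈ Sym2.map vertexIndex '' G.edgeSet ↔ G.Adj a b := by
    simp only [Set.mem_image, map_vertexIndex_eq_iff, exists_eq_right, SimpleGraph.mem_edgeSet]
  rw [← h]
  simp only [inputState]
  split_ifs with h'
  · exact iff_of_true one_ne_zero h'.2
  · exact iff_of_false (not_not_intro rfl) fun h'' => h' ⟨rfl, h''⟩

theorem farr_inputState_of_eq {i j : ℕ} (e : G.edgeSet)
    (h : Sym2.map vertexIndex (e : Sym2 (Option (Fin n))) = s(i, j)) :
    (inputState G w).farr 0 i j = w e := by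
  classical
  simp only [inputState, if_true]
  rw [Finset.sum_eq_single e, if_pos h]
  · intro e' _ hne
    refine if_neg fun h' => hne ?_
    exact Subtype.ext (Sym2.map.injective vertexIndex_injective (h'.trans h.symm))
  · exact fun h' => absurd (Finset.mem_univ e) h'

theorem farr_inputState_adj {a b : Option (Fin n)} (h : G.Adj a b) :
    (inputState G w).farr 0 (vertexIndex a) (vertexIndex b) = w ⟨s(a, b), h⟩ :=
  farr_inputState_of_eq G w ⟨s(a, b), h⟩ (map_vertexIndex_eq_iff.mpr rfl)

theorem farr_inputState_eq_zero_or (a i j : ℕ) :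
    (inputState G w).farr a i j = 0 ∨ ∃ e, (inputState G w).farr a i j = w e := by
  by_cases ha : a = 0
  swap
  · exact .inl (if_neg ha)
  subst ha
  by_cases h : ∃ e : G.edgeSet, Sym2.map vertexIndex (e : Sym2 (Option (Fin n))) = s(i, j)
  · obtain ⟨e, he⟩ := h
    exact .inr ⟨e, farr_inputState_of_eq G w e he⟩
  · push Not at h
    left
    simp only [inputState, if_true]
    exact Finset.sum_eq_zero fun e _ => if_neg (h e)

theorem sizeBounded_inputState {size : F → ℕ} {D : ℕ} (hn : n.size ≤ D) (hD : 1 ≤ D)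
    (h0 : size 0 ≤ D) (hw : ∀ e, size (w e) ≤ D) : SizeBounded size D (inputState G w) := by
  refine ⟨fun x => ?_, fun a i j => ?_, fun a i j => ?_⟩
  · simp only [inputState]
    split_ifs
    · exact hn
    · simp
  · simp only [inputState]
    split_ifs
    · simpa using hD
    · simp
  · rcases farr_inputState_eq_zero_or G w a i j with h | ⟨e, h⟩ <;> rw [h]
    · exact h0
    · exact hw e

variable [LinearOrder F]

theorem completion_inputState_symm (i j : ℕ) :
    completion (inputState G w) i j = completion (inputState G w) j i := by
  simp only [completion, inputState]
  rw [Sym2.eq_swap (a := j) (b := i), Sym2.eq_swap (a := j) (b := 0),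
    Sym2.eq_swap (a := 0) (b := i), max_comm]

theorem completion_inputState_adj {a b : Option (Fin n)} (h : G.Adj a b) :
    completion (inputState G w) (vertexIndex a) (vertexIndex b) = w ⟨s(a, b), h⟩ := by
  rw [completion, if_neg ((narr_inputState_ne_zero_iff G w).mpr h), farr_inputState_adj G w h]

theorem completion_inputState_nonneg {w : G.edgeSet → ℝ} (hw : ∀ e, 0 ≤ w e) (i j : ℕ) :
    0 ≤ completion (inputState G w) i j := by
  have h : ∀ i j, 0 ≤ (inputState G w).farr 0 i j := fun i j => by
    rcases farr_inputState_eq_zero_or G w 0 i j with h | ⟨e, h⟩ <;> rw [h]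
    exact hw e
  rw [completion]
  split_ifs
  · exact le_max_of_le_left (h _ _)
  · exact h _ _

theorem completion_inputState_mono {w w' : G.edgeSet → ℝ} (h : ∀ e, w e ≤ w' e) (i j : ℕ) :
    completion (inputState G w) i j ≤ completion (inputState G w') i j := by
  have hf : ∀ i j, (inputState G w).farr 0 i j ≤ (inputState G w').farr 0 i j := fun i j => by
    simp only [inputState, if_true]
    refine Finset.sum_le_sum fun e _ => ?_
    split_ifs
    · exact h e
    · exact le_rfl
  have hn : (inputState G w).narr = (inputState G w').narr := rfl
  rw [completion, completion, hn]
  split_ifs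
  · exact max_le_max (hf _ _) (hf _ _)
  · exact hf _ _

theorem cast_completion_inputState (w : G.edgeSet → ℚ) (i j : ℕ) :
    ((completion (inputState G w) i j : ℚ) : ℝ) =
      completion (inputState G fun e => (w e : ℝ)) i j := by
  have hf : ∀ i j, (((inputState G w).farr 0 i j : ℚ) : ℝ) =
      (inputState G fun e => (w e : ℝ)).farr 0 i j := fun i j => by
    simp only [inputState, if_true]
    rw [Rat.cast_sum]
    refine Finset.sum_congr rfl fun e _ => ?_
    split_ifs
    · rfl
    · exact Rat.cast_zero
  have hn : (inputState G w).narr = (inputState G fun e => (w e : ℝ)).narr := rfl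
  rw [completion, completion, ← hn, ← hf, ← hf, ← hf]
  split_ifs <;> push_cast <;> rfl

end Input

/-! ### Spanning trees and networks -/

section Trees

variable {n : ℕ} (G : SimpleGraph (Option (Fin n)))

/-- A connected graph on `S ∪ {r}` whose edges are edges of `G` contains a spanning tree of the
induced graph. -/
theorem exists_spanningTree_of_connected {V : Type*} [Fintype V] {G : SimpleGraph (Option V)}
    {S : Finset V}
    (K : SimpleGraph ↥(insert none (some '' (S : Set V)) : Set (Option V))) (hK : K.Connected)
    (hKG : ∀ x y, K.Adj x y → G.Adj x y) :
    ∃ H ∈ spanningTrees G S, ∀ x y, H.Adj x y → ∃ hx hy, K.Adj ⟨x, hx⟩ ⟨y, hy⟩ := by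
  obtain ⟨T, hTK, hT⟩ := hK.exists_isTree_le
  let H : G.Subgraph :=
    { verts := insert none (some '' (S : Set V))
      Adj := fun x y => ∃ hx hy, T.Adj ⟨x, hx⟩ ⟨y, hy⟩
      adj_sub := fun ⟨_, _, h⟩ => hKG _ _ (hTK h)
      edge_vert := fun ⟨hx, _, _⟩ => hx
      symm := ⟨fun _ _ ⟨hx, hy, h⟩ => ⟨hy, hx, h.symm⟩⟩ }
  refine ⟨H, ⟨rfl, ?_⟩, fun x y ⟨hx, hy, h⟩ => ⟨hx, hy, hTK h⟩⟩
  have : H.coe = T := by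
    ext x y
    constructor
    · rintro ⟨_, _, h⟩
      exact h
    · exact fun h => ⟨x.2, y.2, h⟩
  rw [this]
  exact hT

theorem spanningTrees_nonempty {V : Type*} [Fintype V] {G : SimpleGraph (Option V)}
    (hG : RootAdjacent G) (S : Finset V) : (spanningTrees G S).Nonempty := by
  let U : Set (Option V) := insert none (some '' (S : Set V))
  let r : U := ⟨none, Set.mem_insert _ _⟩
  have hr : ∀ x : U, (G.induce U).Reachable x r := by
    rintro ⟨_ | v, hx⟩
    · exact .refl _
    · exact SimpleGraph.Adj.reachable (G := G.induce U) (hG v).symm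
  have hc : (G.induce U).Connected :=
    { preconnected := fun x y => (hr x).trans (hr y).symm
      nonempty := ⟨r⟩ }
  obtain ⟨H, hH, -⟩ := exists_spanningTree_of_connected (S := S) (G.induce U) hc fun _ _ h => h
  exact ⟨H, hH⟩

open Classical in
theorem subgraphWeight_eq {V : Type*} [Fintype V] {G : SimpleGraph (Option V)}
    (w : G.edgeSet → ℝ) (H : G.Subgraph) :
    subgraphWeight w H =
      ∑ e ∈ Finset.univ.filter fun e : G.edgeSet => (e : Sym2 (Option V)) ∈ H.edgeSet, w e := by
  rw [subgraphWeight, Finset.sum_filter]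

theorem subgraphWeight_nonneg {V : Type*} [Fintype V] {G : SimpleGraph (Option V)}
    {w : G.edgeSet → ℝ} (hw : ∀ e, 0 ≤ w e) (H : G.Subgraph) : 0 ≤ subgraphWeight w H := by
  classical
  rw [subgraphWeight_eq]
  exact Finset.sum_nonneg fun e _ => hw e

theorem mstGame_le {V : Type*} [Fintype V] {G : SimpleGraph (Option V)} {w : G.edgeSet → ℝ}
    (hw : ∀ e, 0 ≤ w e) {S : Finset V} {H : G.Subgraph} (hH : H ∈ spanningTrees G S) :
    mstGame G w S ≤ subgraphWeight w H :=
  csInf_le ⟨0, by rintro _ ⟨H, -, rfl⟩; exact subgraphWeight_nonneg hw H⟩ ⟨H, hH, rfl⟩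

theorem le_mstGame {V : Type*} [Fintype V] {G : SimpleGraph (Option V)} (hG : RootAdjacent G)
    {w : G.edgeSet → ℝ} {S : Finset V} {z : ℝ}
    (h : ∀ H ∈ spanningTrees G S, z ≤ subgraphWeight w H) : z ≤ mstGame G w S :=
  le_csInf ((spanningTrees_nonempty hG S).image _) (by rintro _ ⟨H, hH, rfl⟩; exact h H hH)

/-- An increase of the weights raises the cost of a coalition by at most the total increase. -/
theorem mstGame_le_add {V : Type*} [Fintype V] {G : SimpleGraph (Option V)} [Fintype G.edgeSet]
    (hG : RootAdjacent G) {w w' : G.edgeSet → ℝ} (hw' : ∀ e, 0 ≤ w' e) (h : ∀ e, w e ≤ w' e)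
    (S : Finset V) : mstGame G w' S ≤ mstGame G w S + ∑ e, (w' e - w e) := by
  classical
  rw [← sub_le_iff_le_add]
  refine le_mstGame hG fun H hH => ?_
  rw [sub_le_iff_le_add]
  refine (mstGame_le hw' hH).trans ?_
  have hsub : subgraphWeight w' H - subgraphWeight w H ≤ ∑ e, (w' e - w e) := by
    rw [subgraphWeight_eq, subgraphWeight_eq, ← Finset.sum_sub_distrib]
    convert Finset.sum_le_univ_sum_of_nonneg (fun e => sub_nonneg.mpr (h e)) using 1
  linarith

/-- The allocation method: the rule `allocate` for the completed weight matrix. The agent `v` has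
the position `v + 1`. -/
noncomputable def bottleneckAllocation : AllocationMethod :=
  fun n G w v => allocate n (completion (inputState G w)) (v + 1)

theorem bottleneckAllocation_nonneg {w : G.edgeSet → ℝ} (hw : ∀ e, 0 ≤ w e) (v : Fin n) :
    0 ≤ bottleneckAllocation n G w v :=
  le_allocate _ (completion_inputState_nonneg G hw) _

theorem bottleneckAllocation_mono {w w' : G.edgeSet → ℝ} (h : ∀ e, w e ≤ w' e) (v : Fin n) :
    bottleneckAllocation n G w v ≤ bottleneckAllocation n G w' v :=
  allocate_mono _ (completion_inputState_mono G h) _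

variable {G}

/-- The edges of a spanning tree on `S ∪ {r}` form a network to which the core property of the
rule applies. -/
theorem sum_bottleneckAllocation_le_weight {w : G.edgeSet → ℝ} (hw : ∀ e, 0 ≤ w e)
    {S : Finset (Fin n)} {H : G.Subgraph} (hH : H ∈ spanningTrees G S) :
    ∑ v ∈ S, bottleneckAllocation n G w v ≤ subgraphWeight w H := by
  classical
  obtain ⟨hverts, htree⟩ := hH
  let link : G.edgeSet → ℕ × ℕ × ℝ := fun e =>
    (vertexIndex (Quot.out (e : Sym2 (Option (Fin n)))).1,
      vertexIndex (Quot.out (e : Sym2 (Option (Fin n)))).2, w e)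
  have hout : ∀ e : Sym2 (Option (Fin n)), s((Quot.out e).1, (Quot.out e).2) = e :=
    fun e => Quot.out_eq e
  let E := Finset.univ.filter fun e : G.edgeSet => (e : Sym2 (Option (Fin n))) ∈ H.edgeSet
  have hS : ∀ x, x ∈ H.verts → vertexIndex x ∈ S.image (fun v : Fin n => (v : ℕ) + 1) ∨
      vertexIndex x = 0 := by
    intro x hx
    rw [hverts] at hx
    rcases hx with rfl | ⟨v, hv, rfl⟩
    · exact .inr rfl
    · exact .inl (Finset.mem_image_of_mem (fun v : Fin n => (v : ℕ) + 1) hv)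
  have hlink : ∀ x y : H.verts, H.coe.Reachable x y →
      Linked (E.val.map link) (vertexIndex x.1) (vertexIndex y.1) := by
    rintro x y ⟨p⟩
    induction p with
    | nil => exact .refl _
    | @cons x y z hxy _ ih =>
      refine Linked.trans ?_ ih
      have hadj : H.Adj x.1 y.1 := hxy
      have hmem : link ⟨s(x.1, y.1), hadj.adj_sub⟩ ∈ E.val.map link :=
        Multiset.mem_map_of_mem _ (by simpa [E] using hadj)
      have heq := hout s(x.1, y.1)
      rcases Sym2.eq_iff.mp heq with ⟨h1, h2⟩ | ⟨h1, h2⟩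
      · simp only [link, h1, h2] at hmem
        exact .of_mem hmem
      · simp only [link, h1, h2] at hmem
        exact (Linked.of_mem hmem).symm
  have key := sum_allocate_le n (completion_inputState_symm G w)
    (S := S.image fun v : Fin n => (v : ℕ) + 1) (L := E.val.map link) ?_ ?_ ?_
  · rw [Finset.sum_image (fun a _ b _ h => Fin.ext (by simpa using h)), Multiset.map_map] at key
    rw [subgraphWeight_eq]
    exact key
  · intro k hk
    obtain ⟨v, -, rfl⟩ := Finset.mem_image.mp hk
    omega
  · intro a b t hm
    obtain ⟨e, he, heq⟩ := Multiset.mem_map.mp hm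
    have he : (e : Sym2 (Option (Fin n))) ∈ H.edgeSet := by simpa [E] using he
    obtain ⟨rfl, rfl, rfl⟩ : vertexIndex (Quot.out (e : Sym2 (Option (Fin n)))).1 = a ∧
        vertexIndex (Quot.out (e : Sym2 (Option (Fin n)))).2 = b ∧ w e = t := by
      simpa [link] using heq
    have hadj : H.Adj (Quot.out (e : Sym2 (Option (Fin n)))).1
        (Quot.out (e : Sym2 (Option (Fin n)))).2 := by
      rw [← hout e] at he
      exact he
    refine ⟨hS _ hadj.fst_mem, hS _ hadj.snd_mem, hw e, .inr ?_⟩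
    rw [completion_inputState_adj G w hadj.adj_sub]
    exact le_of_eq (congrArg w (Subtype.ext (hout e)))
  · intro k hk
    obtain ⟨v, hv, rfl⟩ := Finset.mem_image.mp hk
    have h1 : some v ∈ H.verts := by rw [hverts]; exact .inr ⟨v, hv, rfl⟩
    have h2 : none ∈ H.verts := by rw [hverts]; exact .inl rfl
    exact hlink ⟨_, h1⟩ ⟨_, h2⟩ (htree.connected.preconnected _ _)

/-- A network of edges of `G` that connects all vertices contains a spanning tree. -/
theorem exists_spanningTree_weight_le {w : G.edgeSet → ℝ} {L : Multiset (ℕ × ℕ × ℝ)}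
    (hL : ∀ a b t, (a, b, t) ∈ L → a ≤ n ∧ b ≤ n ∧ 0 ≤ t ∧
      (a = b ∨ (inputState G w).narr 0 a b ≠ 0 ∧ (inputState G w).farr 0 a b ≤ t))
    (hlink : ∀ v ≤ n, Linked L v 0) :
    ∃ H ∈ spanningTrees G Finset.univ, subgraphWeight w H ≤ (L.map fun e => e.2.2).sum := by
  classical
  let U : Set (Option (Fin n)) :=
    insert none (some '' ((Finset.univ : Finset (Fin n)) : Set (Fin n)))
  have hU : ∀ x, x ∈ U := by
    rintro (_ | v)
    · exact .inl rfl
    · exact .inr ⟨v, by simp, rfl⟩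
  let K : SimpleGraph U := SimpleGraph.fromRel fun x y =>
    ∃ t, (vertexIndex x.1, vertexIndex y.1, t) ∈ L
  have hadj : ∀ (x y : Option (Fin n)) (t : ℝ), x ≠ y → (vertexIndex x, vertexIndex y, t) ∈ L →
      ∃ h : G.Adj x y, w ⟨s(x, y), h⟩ ≤ t := by
    intro x y t hne hm
    obtain ⟨-, -, -, h⟩ := hL _ _ _ hm
    obtain ⟨h1, h2⟩ := h.resolve_left fun h => hne (vertexIndex_injective h)
    have hxy := (narr_inputState_ne_zero_iff G w).mp h1
    exact ⟨hxy, by rwa [farr_inputState_adj G w hxy] at h2⟩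
  have hr : ∀ x y : U, K.Reachable x y := by
    have h0 : ∀ x : U, K.Reachable x ⟨none, hU _⟩ := by
      intro x
      have := (hlink (vertexIndex x.1) (vertexIndex_le _)).lift
        K.reachable_is_equivalence (fun k => ⟨vertexAt n k, hU _⟩) fun a b t hm => by
          obtain ⟨ha, hb, -⟩ := hL _ _ _ hm
          by_cases hab : a = b
          · rw [hab]
          refine SimpleGraph.Adj.reachable ((SimpleGraph.fromRel_adj _ _ _).mpr ⟨fun h => hab ?_,
            .inl ⟨t, ?_⟩⟩)
          · have := congrArg (fun z : U => vertexIndex z.1) h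
            simpa only [vertexIndex_vertexAt ha, vertexIndex_vertexAt hb] using this
          · simpa only [vertexIndex_vertexAt ha, vertexIndex_vertexAt hb] using hm
      simp only [vertexAt_vertexIndex] at this
      simpa [vertexAt] using this
    exact fun x y => (h0 x).trans (h0 y).symm
  obtain ⟨H, hH, hHK⟩ := exists_spanningTree_of_connected (G := G) (S := Finset.univ) K
    { preconnected := hr, nonempty := ⟨⟨none, hU _⟩⟩ } fun x y h => by
      obtain ⟨hne, h⟩ := (SimpleGraph.fromRel_adj _ _ _).mp h
      have hne' : x.1 ≠ y.1 := fun h => hne (Subtype.ext h)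
      rcases h with ⟨t, h⟩ | ⟨t, h⟩
      · exact (hadj _ _ _ hne' h).1
      · exact (hadj _ _ _ hne'.symm h).1.symm
  refine ⟨H, hH, ?_⟩
  -- Distinct edges of the tree come from distinct members of the network.
  have hex : ∀ e : G.edgeSet, (e : Sym2 (Option (Fin n))) ∈ H.edgeSet →
      ∃ l ∈ L, (e : Sym2 (Option (Fin n))) = s(vertexAt n l.1, vertexAt n l.2.1) ∧ w e ≤ l.2.2 := by
    rintro ⟨e, he⟩ heH
    induction e using Sym2.ind with
    | _ x y =>
      obtain ⟨hx, hy, hK⟩ := hHK x y heH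
      obtain ⟨hne, h⟩ := (SimpleGraph.fromRel_adj _ _ _).mp hK
      have hne' : x ≠ y := fun h => hne (Subtype.ext h)
      rcases h with ⟨t, h⟩ | ⟨t, h⟩
      · refine ⟨_, h, ?_, (hadj _ _ _ hne' h).2⟩
        simp only [vertexAt_vertexIndex]
      · refine ⟨_, h, ?_, ?_⟩
        · simp only [vertexAt_vertexIndex]
          exact Sym2.eq_swap
        · obtain ⟨h1, h2⟩ := hadj _ _ _ hne'.symm h
          refine le_trans (le_of_eq (congrArg w (Subtype.ext ?_))) h2
          exact Sym2.eq_swap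
  choose! l hlL hle hwl using hex
  rw [subgraphWeight_eq]
  set E := Finset.univ.filter fun e : G.edgeSet => (e : Sym2 (Option (Fin n))) ∈ H.edgeSet with hE
  have hmemE : ∀ e ∈ E, (e : Sym2 (Option (Fin n))) ∈ H.edgeSet := by simp [hE]
  have hnodup : (E.val.map l).Nodup := by
    refine Multiset.Nodup.map_on (fun e he e' he' h => Subtype.ext ?_) E.nodup
    rw [hle e (hmemE e he), hle e' (hmemE e' he'), h]
  have hsub : E.val.map l ≤ L := (Multiset.le_iff_subset hnodup).mpr fun x hx => by
    obtain ⟨e, he, rfl⟩ := Multiset.mem_map.mp hx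
    exact hlL e (hmemE e he)
  obtain ⟨R, rfl⟩ := Multiset.le_iff_exists_add.mp hsub
  rw [Multiset.map_add, Multiset.sum_add, Multiset.map_map]
  refine le_add_of_le_of_nonneg (Finset.sum_le_sum fun e he => hwl e (hmemE e he))
    (Multiset.sum_nonneg fun x hx => ?_)
  obtain ⟨⟨a, b, t⟩, hm, rfl⟩ := Multiset.mem_map.mp hx
  exact (hL a b t (Multiset.mem_add.mpr (.inr hm))).2.2.1

/-- Edges that were added by the completion are rerouted to the root. -/
theorem exists_spanningTree_weight_le_sum (hG : RootAdjacent G) {w : G.edgeSet → ℝ}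
    (hw : ∀ e, 0 ≤ w e) :
    ∃ H ∈ spanningTrees G Finset.univ,
      subgraphWeight w H ≤ ∑ v, bottleneckAllocation n G w v := by
  obtain ⟨L, hL, hlink, hsum⟩ := exists_linked_sum_eq n (completion_inputState_symm G w)
    (completion_inputState_nonneg G hw)
  have hroot : ∀ a ≤ n, a = 0 ∨ (inputState G w).narr 0 a 0 ≠ 0 := by
    intro a ha
    rw [← vertexIndex_vertexAt ha]
    rcases vertexAt n a with _ | v
    · exact .inl rfl
    · exact .inr ((narr_inputState_ne_zero_iff G w (a := some v) (b := none)).mpr (hG v).symm)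
  have hsymm : ∀ i j, (inputState G w).farr 0 i j = (inputState G w).farr 0 j i := by
    intro i j
    simp only [inputState]
    rw [Sym2.eq_swap (a := i)]
  obtain ⟨L', hlink', hL', hsum'⟩ := exists_linked_of_hub (U := {x | x ≤ n}) (u := 0)
    (R := fun a b t => a ≤ n ∧ b ≤ n ∧ 0 ≤ t ∧
      (a = b ∨ (inputState G w).narr 0 a b ≠ 0 ∧ (inputState G w).farr 0 a b ≤ t))
    hlink fun a b t hm => by
      obtain ⟨ha, hb, ht, hab⟩ := hL a b t hm
      rcases hab with hab | hab
      · exact .inl ⟨ha, hb, ht, .inl hab⟩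
      rw [completion] at hab
      split_ifs at hab with h
      · obtain ⟨h1, h2⟩ := max_le_iff.mp hab
        rw [hsymm] at h2
        exact .inr ⟨⟨ha, Nat.zero_le _, ht, (hroot a ha).imp_right fun h => ⟨h, h1⟩⟩,
          hb, Nat.zero_le _, ht, (hroot b hb).imp_right fun h => ⟨h, h2⟩⟩
      · exact .inl ⟨ha, hb, ht, .inr ⟨h, hab⟩⟩
  obtain ⟨H, hH, hle⟩ := exists_spanningTree_weight_le hL' hlink'
  refine ⟨H, hH, hle.trans (le_of_eq ?_)⟩
  have hIcc : Finset.Icc 1 n = Finset.Ico (0 + 1) (n + 1) := by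
    ext k
    simp only [Finset.mem_Icc, Finset.mem_Ico]
    omega
  rw [hsum', hsum, hIcc, ← Finset.sum_Ico_add', ← Finset.range_eq_Ico, Finset.sum_range]
  rfl

end Trees

/-! ### The core, the Lipschitz constant and the running time -/

section Main

variable {n : ℕ} {G : SimpleGraph (Option (Fin n))}

theorem sum_bottleneckAllocation_le_mstGame (hG : RootAdjacent G) {w : G.edgeSet → ℝ}
    (hw : ∀ e, 0 ≤ w e) (S : Finset (Fin n)) :
    ∑ v ∈ S, bottleneckAllocation n G w v ≤ mstGame G w S :=
  le_mstGame hG fun _ hH => sum_bottleneckAllocation_le_weight hw hH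

theorem sum_bottleneckAllocation (hG : RootAdjacent G) {w : G.edgeSet → ℝ} (hw : ∀ e, 0 ≤ w e) :
    ∑ v, bottleneckAllocation n G w v = mstGame G w Finset.univ := by
  obtain ⟨H, hH, hle⟩ := exists_spanningTree_weight_le_sum hG hw
  exact le_antisymm (sum_bottleneckAllocation_le_mstGame hG hw _) ((mstGame_le hw hH).trans hle)

theorem inApproxCore_bottleneckAllocation (hG : RootAdjacent G) {w : G.edgeSet → ℝ}
    (hw : ∀ e, 0 ≤ w e) {α : ℝ} (hα : 1 ≤ α) :
    InApproxCore α (mstGame G w) (bottleneckAllocation n G w) := by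
  refine ⟨fun S _ => ?_, sum_bottleneckAllocation hG hw⟩
  have h0 : 0 ≤ mstGame G w S := le_mstGame hG fun H _ => subgraphWeight_nonneg hw H
  exact (sum_bottleneckAllocation_le_mstGame hG hw S).trans (le_mul_of_one_le_left h0 hα)

/-- For `u ≤ w` the method is monotone, so that the `ℓ₁` distance of the allocations is the
difference of the costs of the grand coalition. -/
theorem sum_abs_sub_bottleneckAllocation_le_of_le [Fintype G.edgeSet] (hG : RootAdjacent G)
    {u w : G.edgeSet → ℝ} (hu : ∀ e, 0 ≤ u e) (h : ∀ e, u e ≤ w e) :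
    ∑ v, |bottleneckAllocation n G w v - bottleneckAllocation n G u v| ≤ ∑ e, (w e - u e) := by
  have hw : ∀ e, 0 ≤ w e := fun e => (hu e).trans (h e)
  rw [Finset.sum_congr rfl fun v _ =>
    abs_of_nonneg (sub_nonneg.mpr (bottleneckAllocation_mono G h v)), Finset.sum_sub_distrib,
    sum_bottleneckAllocation hG hw, sum_bottleneckAllocation hG hu]
  linarith [mstGame_le_add hG hw h Finset.univ]

theorem hasLipschitzConstant_bottleneckAllocation [Fintype G.edgeSet] (hG : RootAdjacent G)
    {C : ℝ} (hC : 1 ≤ C) : HasLipschitzConstant C (bottleneckAllocation n G) := by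
  intro w w' hw hw'
  -- Compare both with the pointwise minimum of the weights.
  have h0 : ∀ e, 0 ≤ min (w e) (w' e) := fun e => le_min (hw e) (hw' e)
  have h1 := sum_abs_sub_bottleneckAllocation_le_of_le hG h0 fun e => min_le_left (w e) (w' e)
  have h2 := sum_abs_sub_bottleneckAllocation_le_of_le hG h0 fun e => min_le_right (w e) (w' e)
  calc ∑ v, |bottleneckAllocation n G w v - bottleneckAllocation n G w' v|
      ≤ ∑ v, (|bottleneckAllocation n G w v -
            bottleneckAllocation n G (fun e => min (w e) (w' e)) v| +
          |bottleneckAllocation n G w' v -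
            bottleneckAllocation n G (fun e => min (w e) (w' e)) v|) :=
        Finset.sum_le_sum fun v _ =>
          (abs_sub_le _ _ _).trans (add_le_add le_rfl (abs_sub_comm _ _).le)
    _ ≤ ∑ e, (w e - min (w e) (w' e)) + ∑ e, (w' e - min (w e) (w' e)) := by
        rw [Finset.sum_add_distrib]
        exact add_le_add h1 h2
    _ = ∑ e, |w e - w' e| := by
        rw [← Finset.sum_add_distrib]
        refine Finset.sum_congr rfl fun e _ => ?_
        rcases le_total (w e) (w' e) with h | h
        · rw [min_eq_left h, abs_of_nonpos (sub_nonpos.mpr h)]; ring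
        · rw [min_eq_right h, abs_of_nonneg (sub_nonneg.mpr h)]; ring
    _ ≤ C * ∑ e, |w e - w' e| :=
        le_mul_of_one_le_left (Finset.sum_nonneg fun e _ => abs_nonneg _) hC

/-- If the weights have size at most `B`, and zero has size at most one, then all memory contents
have size at most `n + B + 2` during the run: field elements are only copied and compared. -/
theorem runs_allocationProg_inputState {F : Type*} [Field F] [LinearOrder F] {size : F → ℕ}
    {B : ℕ} (h0 : size 0 ≤ 1) (w : G.edgeSet → F) (hw : ∀ e, size (w e) ≤ B) :
    Runs size allocationProg (inputState G w) (200 * (n + B + 3) ^ 4) fun s =>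
      ∀ v : Fin n, output s v = allocate n (completion (inputState G w)) (v + 1) := by
  have hn : ∀ k : ℕ, k.size ≤ k := fun k => Nat.size_le.mpr Nat.lt_two_pow_self
  have hs : SizeBounded size (n + B + 2) (inputState G w) :=
    sizeBounded_inputState G w ((hn n).trans (by omega)) (by omega) (by omega)
      fun e => (hw e).trans (by omega)
  exact (runs_allocationProg (n := n) ((hn _).trans (by omega)) (by omega) hs rfl).mono le_rfl
    fun s h v => h v v.isLt

theorem isPolynomialTime_bottleneckAllocation : IsPolynomialTime bottleneckAllocation := by
  classical
  refine ⟨allocationProg, 200 * (Polynomial.X + 3) ^ 4, 200 * (Polynomial.X + 3) ^ 4,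
    fun n G _ => ⟨fun w _ => ?_, fun w _ => ?_⟩⟩
  · obtain ⟨s, t, he, ht, hs⟩ := runs_allocationProg_inputState (G := G) (size := fun _ : ℝ => 0)
      (B := 0) (Nat.zero_le _) w fun _ => le_rfl
    exact ⟨s, t, he, by simpa using ht, hs⟩
  · obtain ⟨s, t, he, ht, hs⟩ := runs_allocationProg_inputState (G := G) (size := ratSize)
      (B := ∑ e, ratSize (w e)) (by simp [ratSize]) w
      fun e => Finset.single_le_sum (f := fun e => ratSize (w e)) (fun _ _ => Nat.zero_le _)
        (Finset.mem_univ e)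
    refine ⟨s, t, he, by simpa using ht, fun v => ?_⟩
    rw [hs v, map_allocate (φ := ((↑) : ℚ → ℝ)) Rat.cast_mono, bottleneckAllocation]
    simp only [cast_completion_inputState]

end Main

open Classical in
theorem theorem2 :
    ∃ A : AllocationMethod, IsPolynomialTime A ∧
      ∀ (n : ℕ) (G : SimpleGraph (Option (Fin n))), RootAdjacent G →
        (∀ w : G.edgeSet → ℝ, (∀ e, 0 ≤ w e) →
          (∀ v, 0 ≤ A n G w v) ∧ InApproxCore 4 (mstGame G w) (A n G w)) ∧
        HasLipschitzConstant (20 / Real.log 2 + 1) (A n G) := by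
  refine ⟨bottleneckAllocation, isPolynomialTime_bottleneckAllocation, fun n G hG =>
    ⟨fun w hw => ⟨bottleneckAllocation_nonneg G hw,
      inApproxCore_bottleneckAllocation hG hw (by norm_num)⟩,
      hasLipschitzConstant_bottleneckAllocation hG ?_⟩⟩
  have : 0 < Real.log 2 := Real.log_pos one_lt_two
  have : 0 ≤ 20 / Real.log 2 := by positivity
  linarith
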